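/- **Theorem (Structure theorem for trace-surjective algebras).** Let $k$ be a field of characteristic $p>0$ and let $G$ be a finite group of order $p^n$. A commutative $k$-algebra $A$ on which $G$ acts by $k$-algebra automorphisms is called trace-surjective if the trace $A\to A^G$, $a\mapsto\sum_{g\in G}g\cdot a$, is surjective. Let $D_k=k[X_g\mid g\in G]/\bigl(-1+\sum_{g\in G}X_g\bigr)$ with $G$ permuting the variables regularly. A *polynomial retract* of $D_k$ is a $G$-stable, trace-surjective $k$-subalgebra $U=k[Y_0,\dots,Y_{n-1}]\le D_k$, with $Y_0,\dots,Y_{n-1}$ algebraically independent over $k$, such that $D_k=U\oplus J$ for some $G$-stable ideal $J$ of $D_k$. (1) There is a polynomial retract $U=k[Y_0,\dots,Y_{n-1}]$ with triangular action, $g\cdot Y_i=Y_i+f_{g,i}$ with $f_{g,i}\in k[Y_{i+1},\dots,Y_{n-1}]$ for all $g\in G$ and $0\le i\le n-1$, for which the following holds. For every $i$ the equations $$g\cdot\gamma_i-\gamma_i=f_{g,i}^{\,p}-f_{g,i}\qquad(g\in G)$$ have a common solution $\gamma_i\in k[Y_{i+1},\dots,Y_{n-1}]$, and for every choice of such solutions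 $\gamma_0,\dots,\gamma_{n-1}$ the ring of invariants is the polynomial ring $U^G=k[\sigma_0,\dots,\sigma_{n-1}]$ in the algebraically independent elements $$\sigma_i=Y_i-Y_i^p+\gamma_i(Y_{i+1},\dots,Y_{n-1}),\qquad 0\le i\le n-1 .$$ (2) Let $U=k[Y_0,\dots,Y_{n-1}]$ be any polynomial retract of $D_k$ whose ring of invariants is a polynomial ring $U^G=k[\sigma_0,\dots,\sigma_{n-1}]$ with $\sigma_0,\dots,\sigma_{n-1}$ algebraically independent over $k$ (for example one as in (1)). Let $R$ be any commutative $k$-algebra and let $A$ be a commutative trace-surjective $G$-algebra over $k$ with $A^G=R$. Then there are $r_0,\dots,r_{n-1}\in R$ and a $G$-equivariant isomorphism of $R$-algebras $$A\cong R[Y_0,\dots,Y_{n-1}]/\bigl(\sigma_0(\underline Y)-r_0,\dots,\sigma_{n-1}(\underline Y)-r_{n-1}\bigr),$$ where $G$ acts on the right-hand side through the $R$-linear extension of its action on $U=k[Y_0,\dots,Y_{n-1}]$. -/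

import Mathlib

open MvPolynomial

namespace PGroupTs

universe u v w

/-- A commutative ring `A` with an action of the finite group `G` by ring automorphisms is
trace-surjective if the trace `b ↦ ∑ g, g • b` maps `A` onto the ring of invariants `A ^ G`.
(The trace of any element is invariant, so only this inclusion has to be required.) -/
def IsTraceSurjective (G : Type v) [Group G] [Fintype G]
    (A : Type w) [CommRing A] [MulSemiringAction G A] : Prop :=
  ∀ a : A, (∀ g : G, g • a = a) → ∃ b : A, ∑ g : G, g • b = a

section DehomogenizedAlgebra

variable (k : Type u) [Field k] (G : Type v) [Group G] [Fintype G]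

/-- The ideal generated by `-1 + ∑ g, X g` in `Sym_k (k G) = k[X g | g ∈ G]`. -/
noncomputable def relIdeal : Ideal (MvPolynomial G k) := Ideal.span {-1 + ∑ g : G, X g}

/-- The dehomogenized symmetric algebra `D_k = Sym_k (k G) / (-1 + ∑ g, X g)` of the regular
representation of `G`. -/
def DSym : Type (max u v) := MvPolynomial G k ⧸ relIdeal k G

noncomputable instance : CommRing (DSym k G) :=
  inferInstanceAs (CommRing (MvPolynomial G k ⧸ relIdeal k G))

noncomputable instance : Algebra k (DSym k G) :=
  inferInstanceAs (Algebra k (MvPolynomial G k ⧸ relIdeal k G))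

variable {G}

lemma relIdeal_le (g : G) :
    relIdeal k G ≤ (relIdeal k G).comap (rename (R := k) (fun h : G => g * h)) := by
  refine Ideal.span_le.2 ?_
  rintro _ rfl
  have : rename (R := k) (fun h : G => g * h) (-1 + ∑ h : G, X h) = -1 + ∑ h : G, X h := by
    simp only [map_add, map_neg, map_one, map_sum, rename_X]
    congr 1
    exact Fintype.sum_equiv (Equiv.mulLeft g) _ _ (fun _ => rfl)
  simp only [Ideal.coe_comap, Set.mem_preimage, SetLike.mem_coe]
  rw [this]
  exact Ideal.subset_span rfl

/-- The `k`-algebra endomorphism of `D_k` with `x h ↦ x (g * h)`. -/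
noncomputable def DSym.act (g : G) : DSym k G →ₐ[k] DSym k G :=
  Ideal.quotientMapₐ (relIdeal k G) (rename (R := k) (fun h : G => g * h)) (relIdeal_le k g)

lemma DSym.act_mk (g : G) (f : MvPolynomial G k) :
    DSym.act k g (Ideal.Quotient.mk (relIdeal k G) f) =
      Ideal.Quotient.mk (relIdeal k G) (rename (fun h : G => g * h) f) := rfl

/-- The action of `G` on `D_k` induced from the regular representation. -/
noncomputable instance : MulSemiringAction G (DSym k G) where
  smul g x := DSym.act k g x
  one_smul x := by
    obtain ⟨f, rfl⟩ := Ideal.Quotient.mk_surjective x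
    change DSym.act k 1 _ = _
    rw [DSym.act_mk]
    have h1 : (fun h : G => 1 * h) = id := funext one_mul
    rw [h1, rename_id]
    rfl
  mul_smul g h x := by
    obtain ⟨f, rfl⟩ := Ideal.Quotient.mk_surjective x
    change DSym.act k (g * h) _ = DSym.act k g (DSym.act k h _)
    rw [DSym.act_mk, DSym.act_mk, DSym.act_mk, rename_rename]
    congr 3
    funext a
    simp [mul_assoc]
  smul_zero g := map_zero (DSym.act k g)
  smul_add g := map_add (DSym.act k g)
  smul_one g := map_one (DSym.act k g)
  smul_mul g := map_mul (DSym.act k g)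

lemma DSym.smul_def (g : G) (x : DSym k G) : g • x = DSym.act k g x := rfl

/-- A standard subalgebra of `D_k`: a `G`-stable trace-surjective subalgebra `U` such that
`D_k = U ⊕ J` for some `G`-stable ideal `J`. -/
structure IsStandard (U : Subalgebra k (DSym k G)) : Prop where
  smul_mem : ∀ g : G, ∀ x ∈ U, g • x ∈ U
  traceSurjective : ∀ x ∈ U, (∀ g : G, g • x = x) → ∃ b ∈ U, ∑ g : G, g • b = x
  retract : ∃ J : Ideal (DSym k G), (∀ g : G, ∀ x ∈ J, g • x ∈ J) ∧
    IsCompl (Subalgebra.toSubmodule U) (J.restrictScalars k)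

end DehomogenizedAlgebra

/-- A polynomial retract of `D_k`: a standard subalgebra `U = k[y 0, …, y (n - 1)]` which is a
polynomial ring in the elements `y i`. -/
structure PolynomialRetract (k : Type u) [Field k] (G : Type v) [Group G] [Fintype G]
    (n : ℕ) where
  y : Fin n → DSym k G
  algebraicIndependent : AlgebraicIndependent k y
  standard : IsStandard k (Algebra.adjoin k (Set.range y))

namespace PolynomialRetract

variable {k : Type u} [Field k] {G : Type v} [Group G] [Fintype G] {n : ℕ}
  (P : PolynomialRetract k G n)

/-- The polynomial in `k[Y 0, …, Y (n - 1)]` which expresses `g • y i` through the `y j`. -/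
noncomputable def trans (g : G) (i : Fin n) : MvPolynomial (Fin n) k :=
  P.algebraicIndependent.repr
    ⟨g • P.y i, P.standard.smul_mem g _ (Algebra.subset_adjoin ⟨i, rfl⟩)⟩

lemma aeval_trans (g : G) (i : Fin n) : aeval P.y (P.trans g i) = g • P.y i :=
  P.algebraicIndependent.aeval_repr _

/-- The action of `G` on `U = k[Y 0, …, Y (n - 1)]`, extended `R`-linearly to
`R[Y 0, …, Y (n - 1)]`. -/
noncomputable def polyAct (R : Type w) [CommRing R] [Algebra k R] (g : G) :
    MvPolynomial (Fin n) R →ₐ[R] MvPolynomial (Fin n) R :=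
  aeval (fun i => map (algebraMap k R) (P.trans g i))

lemma aeval_aeval_trans (g : G) (f : MvPolynomial (Fin n) k) :
    aeval P.y (aeval (P.trans g) f) = g • aeval P.y f := by
  have : (aeval P.y).comp (aeval (P.trans g)) = (DSym.act k g).comp (aeval P.y) := by
    ext i
    simp [aeval_trans, DSym.smul_def]
  exact DFunLike.congr_fun this f

lemma polyAct_map (R : Type w) [CommRing R] [Algebra k R] (g : G) (f : MvPolynomial (Fin n) k) :
    P.polyAct R g (map (algebraMap k R) f) = map (algebraMap k R) (aeval (P.trans g) f) := by
  induction f using MvPolynomial.induction_on with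
  | C a => simp [polyAct]
  | add p q hp hq => simp only [map_add, hp, hq]
  | mul_X p i hp => rw [map_mul, map_mul, hp, map_mul, map_mul]; simp [polyAct]

lemma trans_one (i : Fin n) : P.trans 1 i = X i :=
  P.algebraicIndependent (by simp [aeval_trans])

lemma trans_mul (g h : G) (i : Fin n) :
    P.trans (g * h) i = aeval (P.trans g) (P.trans h i) :=
  P.algebraicIndependent (by rw [aeval_aeval_trans, aeval_trans, aeval_trans, mul_smul])

lemma polyAct_one (R : Type w) [CommRing R] [Algebra k R] :
    P.polyAct R 1 = AlgHom.id R _ := by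
  ext i : 1
  simp [polyAct, trans_one]

lemma polyAct_mul (R : Type w) [CommRing R] [Algebra k R] (g h : G) :
    P.polyAct R (g * h) = (P.polyAct R g).comp (P.polyAct R h) := by
  ext i : 1
  have hX : ∀ g : G, P.polyAct R g (X i) = map (algebraMap k R) (P.trans g i) := by
    intro g; simp [polyAct]
  rw [AlgHom.comp_apply, hX, hX, polyAct_map, trans_mul]

/-- A system of polynomial generators `σ 0, …, σ (n - 1)` of the ring of invariants `U ^ G`,
written as polynomials in `Y 0, …, Y (n - 1)`: the elements `σ i` are algebraically independent
over `k`, and they generate `U ^ G` as a `k`-algebra. -/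
structure InvariantGenerators where
  σ : Fin n → MvPolynomial (Fin n) k
  algebraicIndependent : AlgebraicIndependent k σ
  mem_adjoin_iff : ∀ f : MvPolynomial (Fin n) k,
    f ∈ Algebra.adjoin k (Set.range σ) ↔ ∀ g : G, g • aeval P.y f = aeval P.y f

namespace InvariantGenerators

variable {P} (S : P.InvariantGenerators)
variable (R : Type w) [CommRing R] [Algebra k R] (r : Fin n → R)

lemma polyAct_σ (g : G) (i : Fin n) :
    P.polyAct R g (map (algebraMap k R) (S.σ i)) = map (algebraMap k R) (S.σ i) := by
  rw [polyAct_map]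
  congr 1
  refine P.algebraicIndependent ?_
  rw [aeval_aeval_trans]
  exact (S.mem_adjoin_iff _).1 (Algebra.subset_adjoin ⟨i, rfl⟩) g

/-- The ideal `(σ 0 - r 0, …, σ (n - 1) - r (n - 1))` of `R[Y 0, …, Y (n - 1)]`. -/
noncomputable def fiberIdeal : Ideal (MvPolynomial (Fin n) R) :=
  Ideal.span (Set.range fun i => map (algebraMap k R) (S.σ i) - C (r i))

/-- The `R`-algebra `R[Y 0, …, Y (n - 1)] / (σ 0 - r 0, …, σ (n - 1) - r (n - 1))`. -/
def Fiber : Type w := MvPolynomial (Fin n) R ⧸ S.fiberIdeal R r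

noncomputable instance : CommRing (S.Fiber R r) :=
  inferInstanceAs (CommRing (MvPolynomial (Fin n) R ⧸ S.fiberIdeal R r))

noncomputable instance : Algebra R (S.Fiber R r) :=
  inferInstanceAs (Algebra R (MvPolynomial (Fin n) R ⧸ S.fiberIdeal R r))

lemma fiberIdeal_le (g : G) :
    S.fiberIdeal R r ≤ (S.fiberIdeal R r).comap (P.polyAct R g) := by
  refine Ideal.span_le.2 ?_
  rintro _ ⟨i, rfl⟩
  have hC : P.polyAct R g (C (r i)) = C (r i) := (P.polyAct R g).commutes (r i)
  simp only [Ideal.coe_comap, Set.mem_preimage, SetLike.mem_coe]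
  rw [map_sub, polyAct_σ, hC]
  exact Ideal.subset_span ⟨i, rfl⟩

/-- The `R`-algebra endomorphism of the quotient induced by the action of `g` on `U`. -/
noncomputable def Fiber.act (g : G) : S.Fiber R r →ₐ[R] S.Fiber R r :=
  Ideal.quotientMapₐ (S.fiberIdeal R r) (P.polyAct R g) (S.fiberIdeal_le R r g)

lemma Fiber.act_mk (g : G) (f : MvPolynomial (Fin n) R) :
    Fiber.act S R r g (Ideal.Quotient.mk (S.fiberIdeal R r) f) =
      Ideal.Quotient.mk (S.fiberIdeal R r) (P.polyAct R g f) := rfl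

/-- The action of `G` on `R[Y] / (σ i - r i)` derived from the action of `G` on `U = k[Y]`. -/
noncomputable instance : MulSemiringAction G (S.Fiber R r) where
  smul g x := Fiber.act S R r g x
  one_smul x := by
    obtain ⟨f, rfl⟩ := Ideal.Quotient.mk_surjective x
    change Fiber.act S R r 1 _ = _
    rw [Fiber.act_mk, polyAct_one]
    rfl
  mul_smul g h x := by
    obtain ⟨f, rfl⟩ := Ideal.Quotient.mk_surjective x
    change Fiber.act S R r (g * h) _ = Fiber.act S R r g (Fiber.act S R r h _)
    rw [Fiber.act_mk, Fiber.act_mk, Fiber.act_mk, polyAct_mul]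
    rfl
  smul_zero g := map_zero (Fiber.act S R r g)
  smul_add g := map_add (Fiber.act S R r g)
  smul_one g := map_one (Fiber.act S R r g)
  smul_mul g := map_mul (Fiber.act S R r g)

end InvariantGenerators

/-- `P.IsTriangular f` says that the action of `G` on `U = k[Y 0, …, Y (n - 1)]` is triangular,
`g • Y i = Y i + f g i` with `f g i ∈ k[Y (i + 1), …, Y (n - 1)]`. -/
def IsTriangular (f : G → Fin n → MvPolynomial (Fin n) k) : Prop :=
  ∀ (g : G) (i : Fin n), f g i ∈ supported k (Set.Ioi i) ∧
    g • P.y i = P.y i + aeval P.y (f g i)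

/-- `γ` solves the cohomology equations `g • γ i - γ i = (f g i) ^ p - f g i` for all `g ∈ G`,
with `γ i ∈ k[Y (i + 1), …, Y (n - 1)]`. -/
def SolvesCohomologyEquations (p : ℕ) (f : G → Fin n → MvPolynomial (Fin n) k)
    (γ : Fin n → MvPolynomial (Fin n) k) : Prop :=
  ∀ i : Fin n, γ i ∈ supported k (Set.Ioi i) ∧
    ∀ g : G, g • aeval P.y (γ i) - aeval P.y (γ i) =
      aeval P.y (f g i) ^ p - aeval P.y (f g i)

end PolynomialRetract

end PGroupTs

/-!
Throughout, an action of `G` on a `k`-algebra `A` is a homomorphism `G →* (A →ₐ[k] A)`. Everything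
rests on an element `w` of trace `1`: with it the first cohomology of `G` in `A`, and in every stable
ideal, is killed by an explicit formula (`cocycle_eq_coboundary`), and `X g ↦ g w` defines an
equivariant homomorphism `D_k → A` (`DSym.exists_hom`).

Existence of a triangular retract is proved by induction along a central subgroup `⟨z⟩` of order `p`.
Let `B` be the polynomial ring already built for `G ⧸ ⟨z⟩`, with trace-one element `w`. As the second
cohomology of the quotient in `B` vanishes, some cocycle `f : G → B` has `f z = 1`
(`exists_cocycle`), and `G` acts on `B[Y]` by `g Y = Y + f g`. Here `-Y ^ (p - 1) w` has trace `1`,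
and its orbit generates `B[Y]` (`TriangularModel.extend`). The cocycle `f ^ p - f` vanishes on `⟨z⟩`,
so it is a coboundary of the quotient, which gives `γ`. The invariants of `z` in `B[Y]` are the
polynomials in the Artin-Schreier element `Y - Y ^ p + γ` over `B`
(`exists_comp_eq_of_comp_X_add_one`); as this element is fixed by `G`, the `G`-invariants have their
coefficients in the invariants of `B` (`mem_adjoin_of_extendAction_eq`). Since one orbit generates,
the final polynomial ring is a quotient of `D_k`, and triangularity allows the quotient map to be
split variable by variable (`TriangularModel.exists_section`): it is a retract.

For an arbitrary polynomial retract `U` and a trace-surjective `A` with invariant ring `R`, restrict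
`D_k → A` to an equivariant `φ : U → A` and let `r i` be the image of `σ i`. For `g ≠ 1` the elements
`u - g u` generate the unit ideal of `U`, because modulo them the trace is divisible by `p`
(`one_mem_span_sub`). Hence `U` has Galois coordinates, `∑ xᵢ g(yᵢ) = δ_{g,1}`
(`exists_galois_coordinates`), and `a ↦ ∑ tr(a φ(yᵢ)) xᵢ` is the inverse of the map from the fibre
`R ⊗ U` over `U ^ G = k[σ]` to `A` (`fiberHom_bijective`).
-/

namespace PGroupTs

/-! ### Sums over cosets -/

lemma sum_eq_sum_quotient_zpowers {G M : Type*} [Group G] [Fintype G] [AddCommMonoid M] (z : G)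
    [Fintype (G ⧸ Subgroup.zpowers z)] (F : G → M) :
    ∑ g, F g = ∑ q : G ⧸ Subgroup.zpowers z, ∑ j ∈ Finset.range (orderOf z),
      F (q.out * z ^ j) := by
  classical
  simp_rw [Finset.sum_range]
  rw [← Fintype.sum_prod_type']
  symm
  refine Fintype.sum_bijective
    (fun x : (G ⧸ Subgroup.zpowers z) × Fin (orderOf z) => x.1.out * z ^ (x.2 : ℕ)) ⟨?_, ?_⟩ _ _
    (fun _ => rfl)
  · rintro ⟨q, i⟩ ⟨q', i'⟩ h
    have hmk : ∀ (q : G ⧸ Subgroup.zpowers z) (j : ℕ),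
        ((q.out * z ^ j : G) : G ⧸ Subgroup.zpowers z) = q := fun q j => by
      conv_rhs => rw [← QuotientGroup.out_eq' q]
      rw [QuotientGroup.eq]
      exact Subgroup.mem_zpowers_iff.2 ⟨-j, by simp⟩
    have hq : q = q' := by
      rw [← hmk q i, ← hmk q' i']
      exact congrArg _ h
    subst hq
    have hi : z ^ (i : ℕ) = z ^ (i' : ℕ) := mul_left_cancel h
    rw [pow_inj_mod, Nat.mod_eq_of_lt i.2, Nat.mod_eq_of_lt i'.2] at hi
    rw [Fin.ext hi]
  · intro g
    have h := QuotientGroup.eq.1 (QuotientGroup.out_eq' (g : G ⧸ Subgroup.zpowers z))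
    rw [mem_zpowers_iff_mem_range_orderOf] at h
    obtain ⟨j, hj, hjg⟩ := Finset.mem_image.1 h
    refine ⟨((g : G ⧸ Subgroup.zpowers z), ⟨j, Finset.mem_range.1 hj⟩), ?_⟩
    simp only
    rw [hjg]
    group

lemma sum_eq_zero_of_mul_left_invariant {G M : Type*} [Group G] [Fintype G] [Semiring M] {g : G}
    (hg : ((orderOf g : ℕ) : M) = 0) (F : G → M) (hF : ∀ x, F (g * x) = F x) : ∑ x, F x = 0 := by
  have : Fintype (G ⧸ Subgroup.zpowers g) := Fintype.ofFinite _
  have hpow : ∀ (j : ℕ) x, F ((g ^ j)⁻¹ * x) = F x := by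
    intro j x
    have h : ∀ j : ℕ, ∀ x, F (g ^ j * x) = F x := by
      intro j
      induction j with
      | zero => simp
      | succ j ih => intro x; rw [pow_succ, mul_assoc, ih, hF]
    rw [← h j, mul_inv_cancel_left]
  have h1 : ∑ x, F x = ∑ x, F x⁻¹ :=
    (Fintype.sum_equiv (Equiv.inv G) (fun x => F x⁻¹) F (fun _ => rfl)).symm
  rw [h1, sum_eq_sum_quotient_zpowers g]
  refine Finset.sum_eq_zero fun q _ => ?_
  simp_rw [mul_inv_rev, hpow]
  rw [Finset.sum_const, Finset.card_range, nsmul_eq_mul, hg, zero_mul]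

section Actions

variable {k A G : Type*} [CommRing k] [CommRing A] [Algebra k A] [Group G] [Fintype G]
  (ρ : G →* (A →ₐ[k] A)) {w : A}

/-- The first cohomology of `G` with values in a trace-surjective algebra vanishes: a cocycle `h`
is the coboundary of an explicit element, built from an element `w` of trace `1`. -/
lemma cocycle_eq_coboundary (hw : ∑ g, ρ g w = 1) (h : G → A)
    (hh : ∀ g x, h (g * x) = h g + ρ g (h x)) (g : G) :
    ρ g (-∑ x, h x * ρ x w) - (-∑ x, h x * ρ x w) = h g := by
  have h1 : ∑ x, h x * ρ x w = ∑ x, h (g * x) * ρ (g * x) w :=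
    (Fintype.sum_equiv (Equiv.mulLeft g) _ _ (fun _ => rfl)).symm
  have h2 : ∑ x, ρ (g * x) w = 1 := by
    rw [← hw]
    exact Fintype.sum_equiv (Equiv.mulLeft g) _ _ (fun _ => rfl)
  have h3 : ρ g (∑ x, h x * ρ x w) = ∑ x, (h (g * x) - h g) * ρ (g * x) w := by
    rw [map_sum]
    refine Finset.sum_congr rfl fun x _ => ?_
    rw [map_mul, hh, map_mul ρ g x, AlgHom.mul_apply]
    ring
  rw [map_neg, h3, h1]
  simp_rw [sub_mul]
  rw [Finset.sum_sub_distrib, ← Finset.mul_sum, h2]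
  ring

/-- If some element has trace `1`, then no `g ≠ 1` acts trivially modulo a proper ideal: the
elements `u - g u` generate the unit ideal. Modulo that ideal the trace is constant along the orbits
of `⟨g⟩`, hence divisible by the order of `g`, which vanishes in characteristic `p`. -/
lemma one_mem_span_sub {p : ℕ} (hp : p.Prime) (hpA : (p : A) = 0) {n : ℕ}
    (hG : Fintype.card G = p ^ n)
    (hw : ∑ g, ρ g w = 1) {g : G} (hg : g ≠ 1) :
    (1 : A) ∈ Ideal.span (Set.range fun u => u - ρ g u) := by
  set I := Ideal.span (Set.range fun u => u - ρ g u) with hI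
  have hinv : ∀ u, Ideal.Quotient.mk I (ρ g u) = Ideal.Quotient.mk I u := by
    intro u
    have h : u - ρ g u ∈ I := Ideal.subset_span ⟨u, rfl⟩
    exact (Ideal.Quotient.eq.2 h).symm
  have hord : ((orderOf g : ℕ) : A) = 0 := by
    have h1 : orderOf g ∣ p ^ n := by
      rw [← hG]
      exact orderOf_dvd_card
    obtain ⟨m, -, hm⟩ := (Nat.dvd_prime_pow hp).1 h1
    cases m with
    | zero => exact absurd (orderOf_eq_one_iff.1 (by simpa using hm)) hg
    | succ m => rw [hm, pow_succ, Nat.cast_mul, hpA, mul_zero]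
  have key : ∑ x, Ideal.Quotient.mk I (ρ x w) = 0 := by
    refine sum_eq_zero_of_mul_left_invariant (g := g) ?_ _ fun x => ?_
    · rw [← map_natCast (Ideal.Quotient.mk I), hord, map_zero]
    · rw [map_mul, AlgHom.mul_apply, hinv]
  rw [← map_sum, hw] at key
  exact Ideal.Quotient.eq_zero_iff_mem.1 key

open scoped TensorProduct in
/-- A trace-surjective algebra over a `p`-group in characteristic `p` has Galois coordinates: pairs
`(xᵢ, yᵢ)` with `∑ xᵢ g(yᵢ) = δ_{g,1}`. Such a system is an element of `A ⊗ A` on which the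
homomorphisms `x ⊗ y ↦ x g(y)` take the values `δ_{g,1}`; a product of elements that each handle a
single `g ≠ 1` does it. -/
lemma exists_galois_coordinates {p : ℕ} (hp : p.Prime) (hpA : (p : A) = 0) {n : ℕ}
    (hG : Fintype.card G = p ^ n) (hw : ∑ g, ρ g w = 1) :
    ∃ S : Finset (A × A), (∑ s ∈ S, s.1 * s.2 = 1) ∧
      ∀ g, g ≠ 1 → ∑ s ∈ S, s.1 * ρ g s.2 = 0 := by
  classical
  let m (g : G) : A ⊗[k] A →ₐ[k] A := Algebra.TensorProduct.productMap (AlgHom.id k A) (ρ g)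
  have hm : ∀ g x y, m g (x ⊗ₜ y) = x * ρ g y := fun g x y => by simp [m]
  have h1 : ∀ g, g ≠ 1 → ∃ t, m 1 t = 1 ∧ m g t = 0 := by
    intro g hg
    have h : ∀ a ∈ Ideal.span (Set.range fun u => u - ρ g u), ∃ t, m 1 t = a ∧ m g t = 0 := by
      intro a ha
      induction ha using Submodule.span_induction with
      | mem a ha =>
        obtain ⟨u, rfl⟩ := ha
        exact ⟨1 ⊗ₜ u - (ρ g u) ⊗ₜ 1, by simp [hm], by simp [hm]⟩
      | zero => exact ⟨0, by simp, by simp⟩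
      | add a b _ _ ha hb =>
        obtain ⟨s, hs, hs'⟩ := ha
        obtain ⟨t, ht, ht'⟩ := hb
        exact ⟨s + t, by simp [hs, ht], by simp [hs', ht']⟩
      | smul c a _ ha =>
        obtain ⟨s, hs, hs'⟩ := ha
        exact ⟨c ⊗ₜ 1 * s, by simp [hm, hs], by simp [hs']⟩
    exact h 1 (one_mem_span_sub ρ hp hpA hG hw hg)
  choose! t ht ht' using h1
  obtain ⟨S, hS⟩ := TensorProduct.exists_finset (∏ g ∈ Finset.univ.erase (1 : G), t g)
  have hsum : ∀ g, ∑ s ∈ S, s.1 * ρ g s.2 = m g (∏ g ∈ Finset.univ.erase (1 : G), t g) := by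
    intro g
    rw [hS, map_sum]
    simp_rw [hm]
  refine ⟨S, ?_, fun g hg => ?_⟩
  · have := hsum 1
    simp only [map_one, AlgHom.one_apply] at this
    rw [this, map_prod]
    exact Finset.prod_eq_one fun g hg => ht g (Finset.ne_of_mem_erase hg)
  · rw [hsum, map_prod]
    exact Finset.prod_eq_zero (Finset.mem_erase.2 ⟨hg, Finset.mem_univ g⟩) (ht' g hg)

end Actions

/-! ### Artin-Schreier polynomials -/

lemma sum_range_natCast_pow {A : Type*} [CommRing A] {p : ℕ} [hp : Fact p.Prime] [CharP A p]
    (m : ℕ) :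
    ∑ j ∈ Finset.range p, (j : A) ^ m = ZMod.castHom (dvd_refl p) A (∑ a : ZMod p, a ^ m) := by
  rw [map_sum]
  refine Finset.sum_nbij (fun j : ℕ => (j : ZMod p)) (fun _ _ => Finset.mem_univ _) ?_ ?_ ?_
  · intro i hi j hj hij
    have := (CharP.cast_eq_iff_mod_eq (ZMod p) p).1 hij
    rwa [Nat.mod_eq_of_lt (Finset.mem_range.1 hi), Nat.mod_eq_of_lt (Finset.mem_range.1 hj)] at this
  · intro a _
    exact ⟨a.val, Finset.mem_coe.2 (Finset.mem_range.2 a.val_lt), ZMod.natCast_zmod_val a⟩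
  · intro j _
    rw [map_pow, map_natCast]

lemma sum_range_add_natCast_pow_pred {A : Type*} [CommRing A] {p : ℕ} [hp : Fact p.Prime]
    [CharP A p] (y : A) :
    ∑ j ∈ Finset.range p, (y + j) ^ (p - 1) = -1 := by
  have hp2 := hp.out.two_le
  simp_rw [add_pow]
  rw [Finset.sum_comm, Finset.sum_range_succ']
  simp_rw [← Finset.sum_mul, ← Finset.mul_sum]
  rw [Finset.sum_eq_zero, zero_add]
  · have h : ∑ a : ZMod p, a ^ (p - 1) = -1 := by
      rw [← Finset.sum_erase_add _ _ (Finset.mem_univ (0 : ZMod p)),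
        Finset.sum_congr rfl fun a ha => ZMod.pow_card_sub_one_eq_one (Finset.ne_of_mem_erase ha)]
      rw [zero_pow (by omega), Finset.sum_const, Finset.card_erase_of_mem (Finset.mem_univ _),
        Finset.card_univ, ZMod.card, nsmul_eq_mul, Nat.cast_sub (by omega)]
      simp
    simp [sum_range_natCast_pow, h]
  · intro m hm
    have hlt : p - 1 - (m + 1) < Fintype.card (ZMod p) - 1 := by
      rw [ZMod.card]
      omega
    rw [sum_range_natCast_pow, FiniteField.sum_pow_lt_card_sub_one _ _ hlt]
    simp

/-- The weights `j` pick out `y` itself, up to a constant, from the span of the powers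
`(y + j) ^ (p - 1)`. -/
lemma sum_range_natCast_mul_add_pow_pred {A : Type*} [CommRing A] {p : ℕ} [hp : Fact p.Prime]
    [CharP A p] (y : A) :
    ∑ j ∈ Finset.range p, (j : A) * (y + j) ^ (p - 1) = y + ∑ j ∈ Finset.range p, (j : A) ^ p := by
  have h : ∀ j : ℕ, (j : A) * (y + j) ^ (p - 1) =
      y ^ p + (j : A) ^ p - y * (y + j) ^ (p - 1) := by
    intro j
    rw [← add_pow_char y (j : A) p]
    obtain ⟨q, hq⟩ : ∃ q, p = q + 1 := ⟨p - 1, by have := hp.out.pos; omega⟩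
    rw [hq, Nat.add_sub_cancel]
    ring
  simp_rw [h]
  rw [Finset.sum_sub_distrib, Finset.sum_add_distrib, ← Finset.mul_sum,
    sum_range_add_natCast_pow_pred, Finset.sum_const, Finset.card_range, nsmul_eq_mul,
    CharP.cast_eq_zero A p]
  ring

open Polynomial in
lemma artinSchreier_monic {B : Type*} [CommRing B] [Nontrivial B] {p : ℕ} (hp : 2 ≤ p) (c : B) :
    (Polynomial.X ^ p - Polynomial.X - Polynomial.C c : B[X]).Monic ∧
      (Polynomial.X ^ p - Polynomial.X - Polynomial.C c : B[X]).natDegree = p := by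
  have h : (Polynomial.X ^ p - Polynomial.X - Polynomial.C c : B[X]) =
      Polynomial.X ^ p - (Polynomial.X + Polynomial.C c) := by ring
  have hd : (Polynomial.X + Polynomial.C c : B[X]).degree < (p : ℕ) := by
    rw [degree_X_add_C]
    exact_mod_cast hp
  have hd' : (Polynomial.X ^ p - Polynomial.X - Polynomial.C c : B[X]).degree = (p : ℕ) := by
    rw [h, degree_sub_eq_left_of_degree_lt (by rwa [degree_X_pow]), degree_X_pow]
  refine ⟨?_, natDegree_eq_of_degree_eq_some hd'⟩
  rw [h]
  exact monic_X_pow_sub (by rwa [degree_X_add_C] at hd ⊢)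

open Polynomial in
/-- Over a domain of characteristic `p`, a polynomial that is invariant under `X ↦ X + 1` is a
polynomial in `X - X ^ p + c`. One divides with remainder: quotient and remainder are again
invariant, and an invariant polynomial of degree `< p` is constant. -/
lemma exists_comp_eq_of_comp_X_add_one {B : Type*} [CommRing B] [IsDomain B] {p : ℕ}
    [hp : Fact p.Prime] [CharP B p] (c : B) (f : B[X]) (hf : f.comp (Polynomial.X + 1) = f) :
    ∃ q : B[X], q.comp (Polynomial.X - Polynomial.X ^ p + Polynomial.C c) = f := by
  have hp2 := hp.out.two_le
  set T : B[X] := Polynomial.X ^ p - Polynomial.X - Polynomial.C c with hT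
  obtain ⟨hTm, hTd⟩ := artinSchreier_monic hp2 c
  rw [← hT] at hTm hTd
  have hTinv : T.comp (Polynomial.X + 1) = T := by
    simp only [hT, sub_comp, pow_comp, X_comp, C_comp,
      add_pow_char Polynomial.X (1 : B[X]) p, one_pow]
    ring
  induction hn : f.natDegree using Nat.strong_induction_on generalizing f with
  | _ n ih =>
  have hdiv := modByMonic_add_div f T
  have hrdeg : (f %ₘ T).degree < T.degree := degree_modByMonic_lt f hTm
  have hnd : (Polynomial.X + 1 : B[X]).natDegree = 1 := by
    simpa using natDegree_X_add_C (1 : B)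
  have huniq : f /ₘ T = (f /ₘ T).comp (Polynomial.X + 1) ∧
      f %ₘ T = (f %ₘ T).comp (Polynomial.X + 1) := by
    refine div_modByMonic_unique _ _ hTm ⟨?_, ?_⟩
    · conv_rhs => rw [← hf, ← hdiv, add_comp, mul_comp, hTinv]
    · by_cases hr : f %ₘ T = 0
      · rw [hr, zero_comp]
        exact hr ▸ hrdeg
      · refine lt_of_le_of_lt degree_le_natDegree ?_
        rw [natDegree_comp, hnd, mul_one, ← degree_eq_natDegree hr]
        exact hrdeg
  have hr : f %ₘ T = Polynomial.C ((f %ₘ T).eval 0) := by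
    have heval : ∀ j : ℕ, (f %ₘ T).eval (j : B) = (f %ₘ T).eval 0 := by
      intro j
      induction j with
      | zero => simp
      | succ j ihj =>
        rw [← ihj]
        conv_rhs => rw [huniq.2]
        simp
    rw [← sub_eq_zero]
    refine eq_zero_of_natDegree_lt_card_of_eval_eq_zero _ (f := fun j : Fin p => ((j : ℕ) : B))
      ?_ ?_ ?_
    · intro i j hij
      have := (CharP.cast_eq_iff_mod_eq B p).1 hij
      rw [Nat.mod_eq_of_lt i.2, Nat.mod_eq_of_lt j.2] at this
      exact Fin.ext this
    · intro j
      rw [Polynomial.eval_sub, heval, Polynomial.eval_C, sub_self]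
    · rw [natDegree_sub_C, Fintype.card_fin, ← hTd]
      exact natDegree_modByMonic_lt f hTm (by rintro h; rw [h, natDegree_one] at hTd; omega)
  by_cases hq : f.natDegree < p
  · refine ⟨Polynomial.C ((f %ₘ T).eval 0), ?_⟩
    rw [C_comp, ← hr, modByMonic_eq_self_iff hTm]
    exact degree_lt_degree (hTd.symm ▸ hq)
  · obtain ⟨q, hq'⟩ := ih (f /ₘ T).natDegree
      (by rw [natDegree_divByMonic _ hTm, hTd]; omega) _ huniq.1.symm rfl
    refine ⟨Polynomial.C ((f %ₘ T).eval 0) - Polynomial.X * q, ?_⟩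
    rw [sub_comp, C_comp, ← hr, mul_comp, X_comp, hq']
    conv_rhs => rw [← hdiv]
    rw [hT]
    ring

open Polynomial in
lemma comp_artinSchreier_injective {B : Type*} [CommRing B] [IsDomain B] {p : ℕ} (hp : 2 ≤ p)
    (c : B) : Function.Injective fun q : B[X] =>
      q.comp (Polynomial.X - Polynomial.X ^ p + Polynomial.C c) := by
  intro q q' h
  have h0 : (q - q').comp (Polynomial.X - Polynomial.X ^ p + Polynomial.C c) = 0 := by
    rw [sub_comp]
    exact sub_eq_zero.2 h
  rcases comp_eq_zero_iff.1 h0 with h | ⟨-, h⟩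
  · exact sub_eq_zero.1 h
  · exfalso
    have h1 := (artinSchreier_monic hp c).2
    have h2 : (Polynomial.X ^ p - Polynomial.X - Polynomial.C c : B[X]) =
        -(Polynomial.X - Polynomial.X ^ p + Polynomial.C c) := by ring
    rw [h2, natDegree_neg, h, natDegree_C] at h1
    omega

/-! ### Central extensions by a group of order `p` -/

lemma exists_mem_center_orderOf_eq {G : Type*} [Group G] [Fintype G] {p n : ℕ}
    [hp : Fact p.Prime] (hG : Fintype.card G = p ^ (n + 1)) :
    ∃ z ∈ Subgroup.center G, orderOf z = p := by
  have hpG : IsPGroup p G := IsPGroup.of_card (n := n + 1) (by rw [Nat.card_eq_fintype_card, hG])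
  have : Nontrivial G := Fintype.one_lt_card_iff_nontrivial.1 (by
    rw [hG]
    exact Nat.one_lt_pow (Nat.succ_ne_zero n) hp.out.one_lt)
  have := hpG.center_nontrivial
  obtain ⟨m, hm0, hm⟩ := (hpG.to_subgroup (Subgroup.center G)).nontrivial_iff_card.1 this
  obtain ⟨x, hx⟩ := exists_prime_orderOf_dvd_card' (G := Subgroup.center G) p
    (hm ▸ dvd_pow_self p hm0.ne')
  exact ⟨x, x.2, by rw [← hx, Subgroup.orderOf_coe]⟩

/-- Exponents of `z` with respect to coset representatives of `⟨z⟩`, read in `k`: they are well defined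
there since `z` has order `p`. -/
lemma exists_cochain {k G : Type*} [Field k] [Group G] {p : ℕ} [CharP k p]
    {z : G} (hz : z ∈ Subgroup.center G) (hzp : orderOf z = p) [Finite G] :
    ∃ c : G → k, ∀ g, c (z * g) = c g + 1 := by
  have h : ∀ g : G, ∃ j : ℕ, g = (g : G ⧸ Subgroup.zpowers z).out * z ^ j := by
    intro g
    have h := QuotientGroup.eq.1 (QuotientGroup.out_eq' (g : G ⧸ Subgroup.zpowers z))
    obtain ⟨j, hj⟩ := (mem_powers_iff_mem_zpowers).2 h
    exact ⟨j, by simp only at hj; rw [hj]; group⟩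
  choose j hj using h
  refine ⟨fun g => j g, fun g => ?_⟩
  have hmk : ((z * g : G) : G ⧸ Subgroup.zpowers z) = g := by
    rw [eq_comm, QuotientGroup.eq, Subgroup.mem_center_iff.1 hz g |>.symm, inv_mul_cancel_left]
    exact Subgroup.mem_zpowers z
  have h1 : z ^ j (z * g) = z ^ (j g + 1) := by
    have h2 := hj (z * g)
    rw [hmk] at h2
    have h3 : z * g = (g : G ⧸ Subgroup.zpowers z).out * z ^ (j g + 1) := by
      rw [pow_succ, ← mul_assoc, ← hj g, Subgroup.mem_center_iff.1 hz g]
    exact mul_left_cancel (h2.symm.trans h3)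
  rw [pow_inj_mod, hzp] at h1
  have := (CharP.cast_eq_iff_mod_eq k p).2 h1
  simpa using this

/-- Let `B` be a trace-surjective algebra for the quotient of `G` by a central subgroup `⟨z⟩` of
order `p`. There is a cocycle of `G` in `B` that restricts to `⟨z⟩ ≅ 𝔽_p`: the obstruction, the class
of the extension in the second cohomology of the quotient, dies in `B`. Since `f ^ p - f` vanishes
at `z`, it is a cocycle of the quotient and hence a coboundary. -/
lemma exists_cocycle {k G B : Type*} [Field k] [Group G] [CommRing B] [Algebra k B]
    {p : ℕ} [Fact p.Prime] [CharP k p] [CharP B p] {z : G} (hz : z ∈ Subgroup.center G)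
    (hzp : orderOf z = p) [Finite G]
    [(Subgroup.zpowers z).Normal] [Fintype (G ⧸ Subgroup.zpowers z)]
    (ρ : G ⧸ Subgroup.zpowers z →* (B →ₐ[k] B)) {w : B} (hw : ∑ x, ρ x w = 1) :
    ∃ f : G → B, (∀ g h : G, f (g * h) = f g + ρ g (f h)) ∧ f z = 1 ∧
      ∃ γ : B, ∀ g : G, ρ g γ - γ = f g ^ p - f g := by
  obtain ⟨c, hc⟩ := exists_cochain (k := k) hz hzp
  have hcz : ∀ (j : ℕ) g, c (z ^ j * g) = c g + j := by
    intro j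
    induction j with
    | zero => simp
    | succ j ih => intro g; rw [pow_succ', mul_assoc, hc, ih]; push_cast; ring
  have hzc : ∀ (j : ℕ) g, g * z ^ j = z ^ j * g := fun j g =>
    Subgroup.mem_center_iff.1 (Subgroup.pow_mem _ hz j) g
  -- The difference `c (g * h) - c h` depends on `h` only modulo `⟨z⟩`.
  have hd : ∀ (g h : G), c (g * (h : G ⧸ Subgroup.zpowers z).out) -
      c (h : G ⧸ Subgroup.zpowers z).out = c (g * h) - c h := by
    intro g h
    have h1 := QuotientGroup.eq.1 (QuotientGroup.out_eq' (h : G ⧸ Subgroup.zpowers z))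
    obtain ⟨j, hj⟩ := (mem_powers_iff_mem_zpowers).2 h1
    have h2 : h = z ^ j * (h : G ⧸ Subgroup.zpowers z).out := by
      rw [← hzc]
      simp only at hj
      rw [hj]
      group
    have h3 : c h = c (h : G ⧸ Subgroup.zpowers z).out + j := by
      conv_lhs => rw [h2]
      rw [hcz]
    have h4 : c (g * h) = c (g * (h : G ⧸ Subgroup.zpowers z).out) + j := by
      conv_lhs => rw [h2]
      rw [← mul_assoc, hzc, mul_assoc, hcz]
    rw [h3, h4]
    ring
  let f : G → B := fun g => ∑ x : G ⧸ Subgroup.zpowers z,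
    (c (g * x.out) - c x.out) • ρ ((g : G ⧸ Subgroup.zpowers z) * x) w
  have hf : ∀ g h : G, f (g * h) = f g + ρ g (f h) := by
    intro g h
    have h1 : f g = ∑ x : G ⧸ Subgroup.zpowers z,
        (c (g * (h * x.out)) - c (h * x.out)) • ρ ((g : G ⧸ Subgroup.zpowers z) * (h * x)) w := by
      refine (Fintype.sum_equiv (Equiv.mulLeft (h : G ⧸ Subgroup.zpowers z)) _ _ fun x => ?_).symm
      rw [← hd g (h * x.out), QuotientGroup.mk_mul, QuotientGroup.out_eq', Equiv.coe_mulLeft]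
    rw [h1]
    simp only [f, map_sum, map_smul]
    rw [← Finset.sum_add_distrib]
    refine Finset.sum_congr rfl fun x _ => ?_
    rw [QuotientGroup.mk_mul, ← AlgHom.mul_apply, ← map_mul, mul_assoc, mul_assoc, ← add_smul]
    congr 1
    ring
  have hz1 : ((z : G) : G ⧸ Subgroup.zpowers z) = 1 :=
    (QuotientGroup.eq_one_iff z).2 (Subgroup.mem_zpowers z)
  have hfz : f z = 1 := by
    simp only [f, hc, hz1, one_mul, add_sub_cancel_left, one_smul]
    exact hw
  refine ⟨f, hf, hfz, ?_⟩
  let h : G → B := fun g => f g ^ p - f g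
  have hh : ∀ g x, h (g * x) = h g + ρ g (h x) := by
    intro g x
    simp only [h, hf, map_sub, map_pow, add_pow_char (f g) (ρ g (f x)) p]
    ring
  -- `h` vanishes on `⟨z⟩`, hence descends to the quotient.
  have hhz : ∀ j : ℕ, h (z ^ j) = 0 := by
    have hh1 : h 1 = 0 := by simpa using hh 1 1
    intro j
    induction j with
    | zero => simpa using hh1
    | succ j ih => rw [pow_succ', hh, ih, map_zero, add_zero]; simp [h, hfz]
  have hout : ∀ g : G, h (g : G ⧸ Subgroup.zpowers z).out = h g := by
    intro g
    have h1 := QuotientGroup.eq.1 (QuotientGroup.out_eq' (g : G ⧸ Subgroup.zpowers z))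
    obtain ⟨j, hj⟩ := (mem_powers_iff_mem_zpowers).2 h1
    have h2 : g = (g : G ⧸ Subgroup.zpowers z).out * z ^ j := by
      simp only at hj
      rw [hj]
      group
    conv_rhs => rw [h2, hh, hhz, map_zero, add_zero]
  refine ⟨-∑ q, h q.out * ρ q w, fun g => ?_⟩
  rw [cocycle_eq_coboundary ρ hw (fun q => h q.out) ?_ g, hout]
  intro a b
  obtain ⟨a, rfl⟩ := QuotientGroup.mk_surjective a
  obtain ⟨b, rfl⟩ := QuotientGroup.mk_surjective b
  rw [← QuotientGroup.mk_mul]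
  simp only [hout]
  exact hh a b

/-! ### Adjoining a variable to a polynomial ring with group action -/

section Extension

variable {k G : Type*} [Field k] [Group G] {n : ℕ}

/-- The extension of an action on `B = k[X 0, …, X (n - 1)]` to `B[Y]` by `g • Y = Y + f g`, for a
cocycle `f` with values in `B`. The new variable `Y` becomes `X 0`, the others move up by one. -/
noncomputable def extendAction (ρ : G →* (MvPolynomial (Fin n) k →ₐ[k] MvPolynomial (Fin n) k))
    (f : G → MvPolynomial (Fin n) k) (hf : ∀ g h, f (g * h) = f g + ρ g (f h)) :
    G →* (MvPolynomial (Fin (n + 1)) k →ₐ[k] MvPolynomial (Fin (n + 1)) k) where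
  toFun g := aeval (Fin.cons (X 0 + rename Fin.succ (f g))
    (fun i => rename Fin.succ (ρ g (X i))) : Fin (n + 1) → MvPolynomial (Fin (n + 1)) k)
  map_one' := by
    have h1 : f 1 = 0 := by simpa using hf 1 1
    ext i : 1
    refine Fin.cases ?_ (fun i => ?_) i
    · simp [h1]
    · simp
  map_mul' g h := by
    have key : ∀ b : MvPolynomial (Fin n) k, aeval (Fin.cons (X 0 + rename Fin.succ (f g))
        (fun i => rename Fin.succ (ρ g (X i))) : Fin (n + 1) → MvPolynomial (Fin (n + 1)) k)
        (rename Fin.succ b) = rename Fin.succ (ρ g b) := by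
      intro b
      rw [aeval_rename]
      have : aeval ((Fin.cons (X 0 + rename Fin.succ (f g))
          (fun i => rename Fin.succ (ρ g (X i))) : Fin (n + 1) → MvPolynomial (Fin (n + 1)) k) ∘
          Fin.succ) = (rename Fin.succ).comp (ρ g) := by
        ext i : 1
        simp
      exact DFunLike.congr_fun this b
    ext i : 1
    refine Fin.cases ?_ (fun i => ?_) i
    · rw [AlgHom.mul_apply, aeval_X, aeval_X, Fin.cons_zero, Fin.cons_zero, map_add, aeval_X,
        Fin.cons_zero, key, hf, map_add, add_assoc]
    · rw [AlgHom.mul_apply, aeval_X, aeval_X, Fin.cons_succ, Fin.cons_succ, key, map_mul,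
        AlgHom.mul_apply]

variable {ρ : G →* (MvPolynomial (Fin n) k →ₐ[k] MvPolynomial (Fin n) k)}
  {f : G → MvPolynomial (Fin n) k} (hf : ∀ g h, f (g * h) = f g + ρ g (f h))

lemma extendAction_X_zero (g : G) :
    extendAction ρ f hf g (X 0) = X 0 + rename Fin.succ (f g) := by
  simp [extendAction]

lemma extendAction_rename (g : G) (b : MvPolynomial (Fin n) k) :
    extendAction ρ f hf g (rename Fin.succ b) = rename Fin.succ (ρ g b) := by
  have : (extendAction ρ f hf g).comp (rename Fin.succ) = (rename Fin.succ).comp (ρ g) := by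
    ext i : 1
    simp [extendAction]
  exact DFunLike.congr_fun this b

lemma finSuccEquiv_rename_succ (b : MvPolynomial (Fin n) k) :
    finSuccEquiv k n (rename Fin.succ b) = Polynomial.C b := by
  induction b using MvPolynomial.induction_on with
  | C a =>
    rw [rename_C, ← algebraMap_eq, AlgEquiv.commutes]
    rfl
  | add a b ha hb => simp only [map_add, ha, hb]
  | mul_X a i ha => rw [map_mul, map_mul, ha, rename_X, finSuccEquiv_X_succ, Polynomial.C_mul]

variable {p : ℕ} (γ : MvPolynomial (Fin n) k)

/-- The inclusion `B[T] → B[Y]` that sends `T` to the Artin-Schreier element `Y - Y ^ p + γ`. -/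
noncomputable def artinSchreierHom (p : ℕ) (γ : MvPolynomial (Fin n) k) :
    Polynomial (MvPolynomial (Fin n) k) →+* MvPolynomial (Fin (n + 1)) k :=
  Polynomial.eval₂RingHom (rename Fin.succ : MvPolynomial (Fin n) k →ₐ[k] _).toRingHom
    (X 0 - X 0 ^ p + rename Fin.succ γ)

lemma artinSchreierHom_X :
    artinSchreierHom p γ Polynomial.X = X 0 - X 0 ^ p + rename Fin.succ γ := by
  simp [artinSchreierHom]

lemma artinSchreierHom_C (b : MvPolynomial (Fin n) k) :
    artinSchreierHom p γ (Polynomial.C b) = rename Fin.succ b := by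
  simp [artinSchreierHom]

lemma finSuccEquiv_artinSchreierHom (q : Polynomial (MvPolynomial (Fin n) k)) :
    finSuccEquiv k n (artinSchreierHom p γ q) =
      q.comp (Polynomial.X - Polynomial.X ^ p + Polynomial.C γ) := by
  induction q using Polynomial.induction_on' with
  | add a b ha hb => rw [map_add, map_add, ha, hb, Polynomial.add_comp]
  | monomial m b =>
    rw [← Polynomial.C_mul_X_pow_eq_monomial, map_mul, map_pow, artinSchreierHom_C,
      artinSchreierHom_X, Polynomial.mul_comp, Polynomial.C_comp, Polynomial.X_pow_comp]
    simp only [map_mul, map_pow, map_add, map_sub, finSuccEquiv_rename_succ, finSuccEquiv_X_zero]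

lemma artinSchreierHom_injective (hp : 2 ≤ p) : Function.Injective (artinSchreierHom p γ) := by
  intro q q' h
  refine comp_artinSchreier_injective hp γ ?_
  simp only
  rw [← finSuccEquiv_artinSchreierHom, ← finSuccEquiv_artinSchreierHom, h]

variable {γ}

lemma extendAction_artinSchreier [Fact p.Prime] [CharP k p]
    (hγ : ∀ g, ρ g γ - γ = f g ^ p - f g) (g : G) :
    extendAction ρ f hf g (X 0 - X 0 ^ p + rename Fin.succ γ) =
      X 0 - X 0 ^ p + rename Fin.succ γ := by
  have h : ρ g γ = γ + (f g ^ p - f g) := by rw [← hγ]; ring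
  rw [map_add, map_sub, map_pow, extendAction_X_zero, extendAction_rename, h,
    add_pow_char (X 0) (rename Fin.succ (f g)) p]
  simp only [map_add, map_sub, map_pow]
  ring

lemma extendAction_artinSchreierHom [Fact p.Prime] [CharP k p]
    (hγ : ∀ g, ρ g γ - γ = f g ^ p - f g) (g : G) (q : Polynomial (MvPolynomial (Fin n) k)) :
    extendAction ρ f hf g (artinSchreierHom p γ q) =
      artinSchreierHom p γ (q.map (ρ g).toRingHom) := by
  induction q using Polynomial.induction_on' with
  | add a b ha hb => rw [map_add, map_add, ha, hb, Polynomial.map_add, map_add]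
  | monomial m b =>
    rw [← Polynomial.C_mul_X_pow_eq_monomial, Polynomial.map_mul, Polynomial.map_pow,
      Polynomial.map_C, Polynomial.map_X]
    simp only [map_mul, map_pow, artinSchreierHom_C, artinSchreierHom_X]
    rw [extendAction_artinSchreier hf hγ, extendAction_rename]
    rfl

lemma finSuccEquiv_extendAction {z : G} (hz : ρ z = 1) (hfz : f z = 1)
    (v : MvPolynomial (Fin (n + 1)) k) :
    finSuccEquiv k n (extendAction ρ f hf z v) =
      (finSuccEquiv k n v).comp (Polynomial.X + 1) := by
  have h0 : extendAction ρ f hf z (X 0) = X 0 + 1 := by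
    rw [extendAction_X_zero, hfz, map_one]
  have hs : ∀ i : Fin n, extendAction ρ f hf z (X i.succ) = X i.succ := by
    intro i
    have h := extendAction_rename hf z (X i)
    rwa [hz, AlgHom.one_apply, rename_X] at h
  have hX : ∀ i, finSuccEquiv k n (extendAction ρ f hf z (X i)) =
      (finSuccEquiv k n (X i)).comp (Polynomial.X + 1) := by
    intro i
    cases i using Fin.cases with
    | zero => rw [h0, map_add, map_one, finSuccEquiv_X_zero, Polynomial.X_comp]
    | succ i => rw [hs, finSuccEquiv_X_succ, Polynomial.C_comp]
  induction v using MvPolynomial.induction_on with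
  | C a =>
    rw [← algebraMap_eq, AlgHom.commutes, AlgEquiv.commutes]
    exact Polynomial.C_comp.symm
  | add a b ha hb => simp only [map_add, ha, hb, Polynomial.add_comp]
  | mul_X a i ha => rw [map_mul, map_mul, map_mul, ha, hX, Polynomial.mul_comp]

/-- If `z` acts trivially on `B` and by `Y ↦ Y + 1`, then the invariants of `G` in `B[Y]` are the
polynomials in `Y - Y ^ p + γ` with coefficients in the invariants of `B`. -/
lemma mem_adjoin_of_extendAction_eq [hp : Fact p.Prime] [CharP k p] {z : G} (hz : ρ z = 1)
    (hfz : f z = 1) (hγ : ∀ g, ρ g γ - γ = f g ^ p - f g)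
    {σ : Fin n → MvPolynomial (Fin n) k}
    (hσ : ∀ b, (∀ g, ρ g b = b) → b ∈ Algebra.adjoin k (Set.range σ))
    {u : MvPolynomial (Fin (n + 1)) k} (hu : ∀ g, extendAction ρ f hf g u = u) :
    u ∈ Algebra.adjoin k (Set.range (Fin.cons (X 0 - X 0 ^ p + rename Fin.succ γ)
      (fun i => rename Fin.succ (σ i)) : Fin (n + 1) → MvPolynomial (Fin (n + 1)) k)) := by
  obtain ⟨q, hq⟩ := exists_comp_eq_of_comp_X_add_one (p := p) γ (finSuccEquiv k n u)
    (by rw [← finSuccEquiv_extendAction hf hz hfz, hu])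
  rw [← finSuccEquiv_artinSchreierHom] at hq
  have hq' : artinSchreierHom p γ q = u := (finSuccEquiv k n).injective hq
  -- The Artin-Schreier element is fixed by `G`, so the action on `u` is the one on coefficients.
  have hcoeff : ∀ g m, ρ g (q.coeff m) = q.coeff m := by
    intro g m
    have h := hu g
    rw [← hq', extendAction_artinSchreierHom hf hγ] at h
    conv_rhs => rw [← artinSchreierHom_injective γ hp.out.two_le h]
    rw [Polynomial.coeff_map]
    rfl
  rw [← hq', Polynomial.as_sum_range_C_mul_X_pow q, map_sum]
  refine Subalgebra.sum_mem _ fun m _ => ?_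
  rw [map_mul, map_pow, artinSchreierHom_C, artinSchreierHom_X]
  refine Subalgebra.mul_mem _ ?_
    (Subalgebra.pow_mem _ (Algebra.subset_adjoin (Set.mem_range.2 ⟨0, rfl⟩)) m)
  have h1 := (Subalgebra.mem_map (f := rename Fin.succ)).2 ⟨_, hσ _ fun g => hcoeff g m, rfl⟩
  rw [AlgHom.map_adjoin] at h1
  refine Algebra.adjoin_mono ?_ h1
  rintro _ ⟨_, ⟨i, rfl⟩, rfl⟩
  exact ⟨i.succ, by simp⟩

/-- Evaluation at the enlarged family is evaluation of the coefficients at `σ`, followed by the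
substitution of `Y - Y ^ p + γ`; both steps are injective. -/
lemma algebraicIndependent_cons_artinSchreier (hp : 2 ≤ p) (γ : MvPolynomial (Fin n) k)
    {σ : Fin n → MvPolynomial (Fin n) k} (hσ : AlgebraicIndependent k σ) :
    AlgebraicIndependent k (Fin.cons (X 0 - X 0 ^ p + rename Fin.succ γ)
      (fun i => rename Fin.succ (σ i)) : Fin (n + 1) → MvPolynomial (Fin (n + 1)) k) := by
  have hinj : Function.Injective fun v : MvPolynomial (Fin (n + 1)) k =>
      artinSchreierHom p γ ((finSuccEquiv k n v).map (aeval σ).toRingHom) :=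
    (artinSchreierHom_injective γ hp).comp
      ((Polynomial.map_injective _ hσ).comp (finSuccEquiv k n).injective)
  have heq : ∀ v, aeval (Fin.cons (X 0 - X 0 ^ p + rename Fin.succ γ)
      (fun i => rename Fin.succ (σ i)) : Fin (n + 1) → MvPolynomial (Fin (n + 1)) k) v =
      artinSchreierHom p γ ((finSuccEquiv k n v).map (aeval σ).toRingHom) := by
    intro v
    induction v using MvPolynomial.induction_on with
    | C a =>
      rw [← algebraMap_eq, AlgHom.commutes, AlgEquiv.commutes]
      have : algebraMap k (Polynomial (MvPolynomial (Fin n) k)) a = Polynomial.C (C a) := rfl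
      rw [this, Polynomial.map_C, artinSchreierHom_C]
      simp
    | add a b ha hb => rw [map_add, map_add, Polynomial.map_add, map_add, ha, hb]
    | mul_X a i ha =>
      rw [map_mul, map_mul, Polynomial.map_mul, map_mul, ha, aeval_X]
      congr 1
      refine Fin.cases ?_ (fun i => ?_) i
      · rw [finSuccEquiv_X_zero, Polynomial.map_X, artinSchreierHom_X, Fin.cons_zero]
      · rw [finSuccEquiv_X_succ, Polynomial.map_C, artinSchreierHom_C, Fin.cons_succ]
        simp
  intro v v' h
  refine hinj ?_
  simp only [← heq]
  exact h

end Extension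

/-! ### Translates under the central subgroup -/

section CentralTranslates

variable {k G : Type*} [Field k] [Group G] {n : ℕ}
  {ρ : G →* (MvPolynomial (Fin n) k →ₐ[k] MvPolynomial (Fin n) k)}
  {f : G → MvPolynomial (Fin n) k} (hf : ∀ g h, f (g * h) = f g + ρ g (f h))
  {z : G}

lemma extendAction_pow_rename (hz : ρ z = 1) (j : ℕ) (b : MvPolynomial (Fin n) k) :
    extendAction ρ f hf (z ^ j) (rename Fin.succ b) = rename Fin.succ b := by
  rw [extendAction_rename, map_pow, hz, one_pow, AlgHom.one_apply]

lemma extendAction_pow_X_zero (hfz : f z = 1) (j : ℕ) :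
    extendAction ρ f hf (z ^ j) (X 0) = X 0 + (j : MvPolynomial (Fin (n + 1)) k) := by
  induction j with
  | zero => simp
  | succ j ih =>
    rw [pow_succ, map_mul, AlgHom.mul_apply, extendAction_X_zero, hfz, map_one, map_add, ih,
      map_one]
    push_cast
    ring

variable {p : ℕ}

lemma extendAction_pow_mul (hz : ρ z = 1) (hfz : f z = 1) (w : MvPolynomial (Fin n) k) (j : ℕ) :
    extendAction ρ f hf (z ^ j) (-X 0 ^ (p - 1) * rename Fin.succ w) =
      -((X 0 + (j : MvPolynomial (Fin (n + 1)) k)) ^ (p - 1) * rename Fin.succ w) := by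
  rw [map_mul, map_neg, map_pow, extendAction_pow_X_zero hf hfz,
    extendAction_pow_rename hf hz, neg_mul]

variable [Fact p.Prime] [CharP k p]

lemma sum_extendAction_pow (hz : ρ z = 1) (hfz : f z = 1) (w : MvPolynomial (Fin n) k) :
    ∑ j ∈ Finset.range p, extendAction ρ f hf (z ^ j) (-X 0 ^ (p - 1) * rename Fin.succ w) =
      rename Fin.succ w := by
  simp_rw [extendAction_pow_mul hf hz hfz]
  rw [Finset.sum_neg_distrib, ← Finset.sum_mul, sum_range_add_natCast_pow_pred]
  ring

lemma sum_mul_extendAction_pow (hz : ρ z = 1) (hfz : f z = 1) (w : MvPolynomial (Fin n) k) :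
    ∑ j ∈ Finset.range p, (j : MvPolynomial (Fin (n + 1)) k) *
        extendAction ρ f hf (z ^ j) (-X 0 ^ (p - 1) * rename Fin.succ w) =
      -((X 0 + ∑ j ∈ Finset.range p, (j : MvPolynomial (Fin (n + 1)) k) ^ p) *
        rename Fin.succ w) := by
  simp_rw [extendAction_pow_mul hf hz hfz, mul_neg, ← mul_assoc]
  rw [Finset.sum_neg_distrib, ← Finset.sum_mul, sum_range_natCast_mul_add_pow_pred]

end CentralTranslates

/-! ### The triangular polynomial ring generated by one orbit -/

/-- A triangular action of `G` on `k[X 0, …, X (n - 1)]`, given as a homomorphism to the algebra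
endomorphisms, together with an element of trace `1` whose orbit generates the algebra. -/
structure TriangularModel (k G : Type*) [Field k] [Group G] [Fintype G] (n : ℕ) where
  ρ : G →* (MvPolynomial (Fin n) k →ₐ[k] MvPolynomial (Fin n) k)
  f : G → Fin n → MvPolynomial (Fin n) k
  f_mem : ∀ g i, f g i ∈ supported k (Set.Ioi i)
  ρ_X : ∀ g i, ρ g (X i) = X i + f g i
  w : MvPolynomial (Fin n) k
  trace_w : ∑ g, ρ g w = 1
  adjoin_orbit : Algebra.adjoin k (Set.range fun g => ρ g w) = ⊤

namespace TriangularModel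

/-- `γ` solves `g γᵢ - γᵢ = f_{g,i} ^ p - f_{g,i}`, with `γᵢ` a polynomial in the variables after
the `i`-th. -/
def IsSolution {k G : Type*} [Field k] [Group G] [Fintype G] {n : ℕ} (T : TriangularModel k G n)
    (p : ℕ) (γ : Fin n → MvPolynomial (Fin n) k) : Prop :=
  ∀ i, γ i ∈ supported k (Set.Ioi i) ∧ ∀ g, T.ρ g (γ i) - γ i = T.f g i ^ p - T.f g i

end TriangularModel

lemma vars_rename_succ {k : Type*} [Field k] {n : ℕ} (b : MvPolynomial (Fin n) k) :
    (rename Fin.succ b).vars = b.vars.image Fin.succ := by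
  classical
  rw [vars_def, vars_def, degrees_rename_of_injective (Fin.succ_injective n)]
  exact Multiset.toFinset_map _ _

lemma rename_succ_mem_supported {k : Type*} [Field k] {n : ℕ} {b : MvPolynomial (Fin n) k}
    {i : Fin n} : rename Fin.succ b ∈ supported k (Set.Ioi i.succ) ↔
      b ∈ supported k (Set.Ioi i) := by
  rw [mem_supported, mem_supported, vars_rename_succ]
  simp [Set.subset_def]

lemma rename_succ_mem_supported_zero {k : Type*} [Field k] {n : ℕ} (b : MvPolynomial (Fin n) k) :
    rename Fin.succ b ∈ supported k (Set.Ioi (0 : Fin (n + 1))) := by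
  rw [mem_supported, vars_rename_succ]
  simp [Set.subset_def]

lemma exists_rename_succ {k : Type*} [Field k] {n : ℕ} {b : MvPolynomial (Fin (n + 1)) k}
    {i : Fin (n + 1)} (hb : b ∈ supported k (Set.Ioi i)) : ∃ b', rename Fin.succ b' = b := by
  refine exists_rename_eq_of_vars_subset_range b Fin.succ (Fin.succ_injective n) ?_
  refine (mem_supported.1 hb).trans fun j hj => ?_
  exact Fin.exists_succ_eq.2 (Fin.ne_zero_of_lt hj)

lemma exists_triangularModel_zero {k G : Type*} [Field k] [Group G] [Fintype G]
    (hG : Fintype.card G = 1) : Nonempty (TriangularModel k G 0) := by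
  refine ⟨{ ρ := 1, f := 0, f_mem := fun _ i => i.elim0, ρ_X := fun _ i => i.elim0, w := 1,
            trace_w := ?_, adjoin_orbit := ?_ }⟩
  · simp [hG]
  · refine eq_top_iff.2 fun u _ => ?_
    rw [eq_C_of_isEmpty u]
    exact Subalgebra.algebraMap_mem _ _

section Step

variable {k G : Type*} [Field k] [Group G] {n : ℕ} {z : G} [(Subgroup.zpowers z).Normal]
  [Fintype (G ⧸ Subgroup.zpowers z)] (T : TriangularModel k (G ⧸ Subgroup.zpowers z) n)
  {f : G → MvPolynomial (Fin n) k}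
  (hf : ∀ g h, f (g * h) = f g + T.ρ.comp (QuotientGroup.mk' _) g (f h))

lemma TriangularModel.comp_mk'_self : T.ρ.comp (QuotientGroup.mk' _) z = 1 := by
  have h : QuotientGroup.mk' (Subgroup.zpowers z) z = 1 :=
    (QuotientGroup.eq_one_iff z).2 (Subgroup.mem_zpowers z)
  rw [MonoidHom.comp_apply, h, map_one]

lemma TriangularModel.rename_mem_of_orbit {O : Subalgebra k (MvPolynomial (Fin (n + 1)) k)}
    (hO : ∀ g, ∀ u ∈ O, extendAction _ f hf g u ∈ O) (hw : rename Fin.succ T.w ∈ O)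
    (b : MvPolynomial (Fin n) k) : rename Fin.succ b ∈ O := by
  have hb : b ∈ Algebra.adjoin k (Set.range fun x => T.ρ x T.w) := by
    rw [T.adjoin_orbit]
    trivial
  have h : rename Fin.succ b ∈ (Algebra.adjoin k (Set.range fun x => T.ρ x T.w)).map
      (rename Fin.succ) := Subalgebra.mem_map.2 ⟨b, hb, rfl⟩
  rw [AlgHom.map_adjoin] at h
  refine Algebra.adjoin_le ?_ h
  rintro _ ⟨_, ⟨x, rfl⟩, rfl⟩
  obtain ⟨g, rfl⟩ := QuotientGroup.mk_surjective x
  have h1 := hO g _ hw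
  rw [extendAction_rename] at h1
  exact h1

variable [Fintype G] {p : ℕ} [Fact p.Prime] [CharP k p]

/-- The action on `B[Y]` attached to a cocycle `f` with `f z = 1` has `-Y ^ (p - 1) w` as an element
of trace `1` with generating orbit: the `⟨z⟩`-translates of that element span `w` and, up to a
multiple of `w`, also `w Y`; the trace of the latter is `Y` up to an element of `B`. -/
noncomputable def TriangularModel.extend (hzp : orderOf z = p) (hfz : f z = 1) :
    TriangularModel k G (n + 1) where
  ρ := extendAction _ f hf
  f g := Fin.cons (rename Fin.succ (f g)) fun i => rename Fin.succ (T.f g i)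
  f_mem g i := by
    cases i using Fin.cases with
    | zero => exact rename_succ_mem_supported_zero _
    | succ i => exact rename_succ_mem_supported.2 (T.f_mem g i)
  ρ_X g i := by
    cases i using Fin.cases with
    | zero => exact extendAction_X_zero hf g
    | succ i =>
      have h := extendAction_rename hf g (X i)
      rw [rename_X] at h
      rw [h, Fin.cons_succ, MonoidHom.comp_apply, QuotientGroup.mk'_apply, T.ρ_X, map_add,
        rename_X]
  w := -X 0 ^ (p - 1) * rename Fin.succ T.w
  trace_w := by
    rw [sum_eq_sum_quotient_zpowers z, hzp]
    simp_rw [map_mul (extendAction _ f hf), AlgHom.mul_apply, ← map_sum]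
    rw [sum_extendAction_pow hf T.comp_mk'_self hfz]
    simp_rw [extendAction_rename]
    have h : ∀ q : G ⧸ Subgroup.zpowers z, T.ρ.comp (QuotientGroup.mk' _) q.out = T.ρ q := by
      intro q
      rw [MonoidHom.comp_apply, QuotientGroup.mk'_apply, QuotientGroup.out_eq']
    simp_rw [h]
    rw [← map_sum, T.trace_w, map_one]
  adjoin_orbit := by
    set w := -X 0 ^ (p - 1) * rename Fin.succ T.w with hw
    set ρ := extendAction _ f hf with hρ
    set O := Algebra.adjoin k (Set.range fun g => ρ g w) with hOdef
    have horb : ∀ g, ρ g w ∈ O := fun g => Algebra.subset_adjoin (Set.mem_range_self g)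
    have hO : ∀ g, ∀ u ∈ O, ρ g u ∈ O := by
      intro g u hu
      have h : ρ g u ∈ O.map (ρ g) := Subalgebra.mem_map.2 ⟨u, hu, rfl⟩
      rw [hOdef, AlgHom.map_adjoin] at h
      refine Algebra.adjoin_le ?_ h
      rintro _ ⟨_, ⟨x, rfl⟩, rfl⟩
      have h1 := horb (g * x)
      rwa [map_mul ρ, AlgHom.mul_apply] at h1
    have hw' : rename Fin.succ T.w ∈ O := by
      rw [← sum_extendAction_pow (p := p) hf T.comp_mk'_self hfz]
      exact Subalgebra.sum_mem _ fun j _ => horb _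
    have hren : ∀ b, rename Fin.succ b ∈ O := T.rename_mem_of_orbit hf hO hw'
    have hwX : X 0 * rename Fin.succ T.w ∈ O := by
      have h1 : -((X 0 + ∑ j ∈ Finset.range p, (j : MvPolynomial (Fin (n + 1)) k) ^ p) *
          rename Fin.succ T.w) ∈ O := by
        rw [← sum_mul_extendAction_pow (p := p) hf T.comp_mk'_self hfz]
        exact Subalgebra.sum_mem _ fun j _ => Subalgebra.mul_mem _ (natCast_mem _ j) (horb _)
      have h2 : (∑ j ∈ Finset.range p, (j : MvPolynomial (Fin (n + 1)) k) ^ p) *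
          rename Fin.succ T.w ∈ O := Subalgebra.mul_mem _
        (Subalgebra.sum_mem _ fun j _ => Subalgebra.pow_mem _ (natCast_mem _ j) _) hw'
      have h3 := Subalgebra.neg_mem _ (Subalgebra.add_mem _ h1 h2)
      convert h3 using 1
      ring
    have hX0 : X 0 ∈ O := by
      have h1 : ∑ q : G ⧸ Subgroup.zpowers z, ρ q.out (X 0 * rename Fin.succ T.w) ∈ O :=
        Subalgebra.sum_mem _ fun q _ => hO _ _ hwX
      have h2 : ∑ q : G ⧸ Subgroup.zpowers z, ρ q.out (X 0 * rename Fin.succ T.w) =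
          X 0 + rename Fin.succ (∑ q : G ⧸ Subgroup.zpowers z, f q.out * T.ρ q T.w) := by
        have h3 : ∀ q : G ⧸ Subgroup.zpowers z, ρ q.out (X 0 * rename Fin.succ T.w) =
            X 0 * rename Fin.succ (T.ρ q T.w) + rename Fin.succ (f q.out * T.ρ q T.w) := by
          intro q
          rw [map_mul, hρ, extendAction_X_zero, extendAction_rename, MonoidHom.comp_apply,
            QuotientGroup.mk'_apply, QuotientGroup.out_eq', add_mul, map_mul]
        simp_rw [h3]
        rw [Finset.sum_add_distrib, ← Finset.mul_sum, ← map_sum, ← map_sum, T.trace_w, map_one,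
          mul_one]
      rw [h2] at h1
      have h4 := Subalgebra.sub_mem _ h1
        (hren (∑ q : G ⧸ Subgroup.zpowers z, f q.out * T.ρ q T.w))
      rwa [add_sub_cancel_right] at h4
    refine eq_top_iff.2 ?_
    rw [← adjoin_range_X]
    refine Algebra.adjoin_le ?_
    rintro _ ⟨i, rfl⟩
    cases i using Fin.cases with
    | zero => exact hX0
    | succ i => simpa using hren (X i)

end Step

/-- The polynomial ring with triangular action, by induction along central extensions, together with
the Artin-Schreier description of its invariants. -/
theorem exists_triangularModel {k : Type*} [Field k] {p : ℕ} [hp : Fact p.Prime] [CharP k p]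
    (n : ℕ) : ∀ {G : Type*} [Group G] [Fintype G], Fintype.card G = p ^ n →
    ∃ T : TriangularModel k G n, (∃ γ, T.IsSolution p γ) ∧ ∀ γ, T.IsSolution p γ →
      AlgebraicIndependent k (fun i => X i - X i ^ p + γ i) ∧
      ∀ u, (∀ g, T.ρ g u = u) → u ∈ Algebra.adjoin k (Set.range fun i => X i - X i ^ p + γ i) := by
  induction n with
  | zero =>
    intro G _ _ hG
    obtain ⟨T⟩ := exists_triangularModel_zero (k := k) (G := G) (by simpa using hG)
    refine ⟨T, ⟨0, fun i => i.elim0⟩, fun γ _ => ⟨?_, fun u _ => ?_⟩⟩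
    · rw [algebraicIndependent_empty_type_iff]
      exact C_injective _ _
    · rw [eq_C_of_isEmpty u]
      exact Subalgebra.algebraMap_mem _ _
  | succ n ih =>
    intro G _ _ hG
    obtain ⟨z, hz, hzp⟩ := exists_mem_center_orderOf_eq hG
    have : (Subgroup.zpowers z).Normal := ⟨fun x hx g => by
      have hx' : x ∈ Subgroup.center G := (Subgroup.zpowers_le.2 hz) hx
      rwa [Subgroup.mem_center_iff.1 hx' g, mul_inv_cancel_right]⟩
    let _ : Fintype (G ⧸ Subgroup.zpowers z) := Fintype.ofFinite _
    have hQ : Fintype.card (G ⧸ Subgroup.zpowers z) = p ^ n := by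
      have h := Subgroup.card_eq_card_quotient_mul_card_subgroup (Subgroup.zpowers z)
      rw [Nat.card_zpowers, hzp, Nat.card_eq_fintype_card, Nat.card_eq_fintype_card, hG,
        pow_succ] at h
      exact (Nat.eq_of_mul_eq_mul_right hp.out.pos h).symm
    obtain ⟨T, ⟨γ, hγ⟩, hT⟩ := ih hQ
    obtain ⟨f, hf, hfz, γ₀, hγ₀⟩ := exists_cocycle (k := k) (p := p) hz hzp T.ρ T.trace_w
    replace hf : ∀ g h, f (g * h) = f g + T.ρ.comp (QuotientGroup.mk' _) g (f h) := hf
    refine ⟨T.extend hf hzp hfz,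
      ⟨Fin.cons (rename Fin.succ γ₀) fun i => rename Fin.succ (γ i), fun i => ?_⟩, fun γ' hγ' => ?_⟩
    · cases i using Fin.cases with
      | zero =>
        refine ⟨rename_succ_mem_supported_zero _, fun g => ?_⟩
        simp only [TriangularModel.extend, Fin.cons_zero, extendAction_rename]
        rw [← map_sub, ← map_pow, ← map_sub]
        exact congrArg _ (hγ₀ g)
      | succ i =>
        refine ⟨rename_succ_mem_supported.2 (hγ i).1, fun g => ?_⟩
        simp only [TriangularModel.extend, Fin.cons_succ, extendAction_rename]
        rw [← map_sub, ← map_pow, ← map_sub]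
        exact congrArg _ ((hγ i).2 g)
    · have hren : ∀ i, ∃ b, rename Fin.succ b = γ' i := fun i => exists_rename_succ (hγ' i).1
      choose δ hδ using hren
      have hγ0 : ∀ g, T.ρ.comp (QuotientGroup.mk' _) g (δ 0) - δ 0 = f g ^ p - f g := by
        intro g
        have h := (hγ' 0).2 g
        simp only [TriangularModel.extend, Fin.cons_zero, ← hδ, extendAction_rename] at h
        rw [← map_sub, ← map_pow, ← map_sub] at h
        exact rename_injective _ (Fin.succ_injective n) h
      have hγs : T.IsSolution p fun i => δ i.succ := by
        refine fun i => ⟨rename_succ_mem_supported.1 (by rw [hδ]; exact (hγ' i.succ).1), fun x => ?_⟩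
        obtain ⟨g, rfl⟩ := QuotientGroup.mk_surjective x
        have h := (hγ' i.succ).2 g
        simp only [TriangularModel.extend, Fin.cons_succ, ← hδ, extendAction_rename] at h
        rw [← map_sub, ← map_pow, ← map_sub] at h
        exact rename_injective _ (Fin.succ_injective n) h
      have hσ : (fun i => X i - X i ^ p + γ' i) =
          (Fin.cons (X 0 - X 0 ^ p + rename Fin.succ (δ 0)) (fun i => rename Fin.succ
            (X i - X i ^ p + δ i.succ)) : Fin (n + 1) → MvPolynomial (Fin (n + 1)) k) := by
        funext i
        cases i using Fin.cases with
        | zero => simp [hδ]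
        | succ i => simp [hδ]
      obtain ⟨h1, h2⟩ := hT _ hγs
      rw [hσ]
      refine ⟨algebraicIndependent_cons_artinSchreier hp.out.two_le _ h1, fun u hu => ?_⟩
      refine mem_adjoin_of_extendAction_eq hf (T.comp_mk'_self) hfz hγ0 (fun b hb => h2 b ?_) hu
      intro x
      obtain ⟨g, rfl⟩ := QuotientGroup.mk_surjective x
      exact hb g

/-! ### The universal property of `D_k` -/

namespace DSym

variable (k G : Type*) [Field k] [Group G] [Fintype G]

/-- The action of `G` on `D_k` as a homomorphism to the algebra endomorphisms. -/
noncomputable def actHom : G →* (DSym k G →ₐ[k] DSym k G) where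
  toFun g := act k g
  map_one' := AlgHom.ext fun x => one_smul G x
  map_mul' g h := AlgHom.ext fun x => mul_smul g h x

lemma sum_actHom_mk_X :
    ∑ g, actHom k G g (Ideal.Quotient.mk (relIdeal k G) (X 1)) = 1 := by
  have h : ∀ g, actHom k G g (Ideal.Quotient.mk (relIdeal k G) (X 1)) =
      Ideal.Quotient.mk (relIdeal k G) (X g) := by
    intro g
    change act k g _ = _
    rw [act_mk, rename_X, mul_one]
  simp_rw [h]
  have h1 : Ideal.Quotient.mk (relIdeal k G) (-1 + ∑ g : G, X g) = 0 :=
    Ideal.Quotient.eq_zero_iff_mem.2 (Ideal.subset_span rfl)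
  rw [map_add, map_neg, map_one, map_sum, neg_add_eq_zero] at h1
  exact h1.symm

variable {k G} {A : Type*} [CommRing A] [Algebra k A]

/-- An element `w` of trace `1` in a `G`-algebra determines an equivariant homomorphism from `D_k`
that maps the variables to the orbit of `w`. -/
lemma exists_hom (ρ : G →* (A →ₐ[k] A)) {w : A} (hw : ∑ g, ρ g w = 1) :
    ∃ ψ : DSym k G →ₐ[k] A, (∀ g, ρ g w ∈ ψ.range) ∧
      ∀ (g : G) (x : DSym k G), ψ (g • x) = ρ g (ψ x) := by
  let ψ : DSym k G →ₐ[k] A := Ideal.Quotient.liftₐ (relIdeal k G) (aeval fun g => ρ g w) (by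
    intro a ha
    refine (Ideal.span_le (I := RingHom.ker (aeval fun g => ρ g w))).2 ?_ ha
    rintro _ rfl
    simp only [SetLike.mem_coe, RingHom.mem_ker, map_add, map_neg, map_one, map_sum, aeval_X, hw]
    ring)
  have hψ : ∀ f, ψ (Ideal.Quotient.mk (relIdeal k G) f) = aeval (fun g => ρ g w) f :=
    fun f => rfl
  refine ⟨ψ, fun g => ⟨Ideal.Quotient.mk (relIdeal k G) (X g), (hψ _).trans (aeval_X _ _)⟩,
    fun g x => ?_⟩
  obtain ⟨f, rfl⟩ := Ideal.Quotient.mk_surjective x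
  change ψ (act k g _) = _
  rw [act_mk, hψ, aeval_rename]
  refine Eq.trans ?_ (congrArg (ρ g) (hψ f).symm)
  have h : aeval ((fun g => ρ g w) ∘ fun h => g * h) = (ρ g).comp (aeval fun g => ρ g w) := by
    ext h : 1
    simp
  exact DFunLike.congr_fun h f

end DSym

/-! ### Retracts from triangular models -/

lemma algHom_eq_of_mem_supported {k ι A : Type*} [CommRing k] [CommRing A] [Algebra k A] {s : Set ι}
    {φ ψ : MvPolynomial ι k →ₐ[k] A} (h : ∀ i ∈ s, φ (X i) = ψ (X i)) {b : MvPolynomial ι k}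
    (hb : b ∈ supported k s) : φ b = ψ b := by
  refine (Algebra.adjoin_le (S := AlgHom.equalizer φ ψ) ?_) hb
  rintro _ ⟨i, hi, rfl⟩
  exact h i hi

namespace TriangularModel

variable {k G : Type*} [Field k] [Group G] [Fintype G] {n : ℕ} (T : TriangularModel k G n)

lemma f_mul (g h : G) (i : Fin n) : T.f (g * h) i = T.f g i + T.ρ g (T.f h i) := by
  have h1 := T.ρ_X (g * h) i
  rw [map_mul, AlgHom.mul_apply, T.ρ_X, map_add, T.ρ_X, add_assoc] at h1
  exact (add_left_cancel h1).symm

variable {A : Type*} [CommRing A] [Algebra k A] (ρ : G →* (A →ₐ[k] A)) {t : A}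

/-- An equivariant surjection `π` from a trace-surjective algebra onto a triangular model has an
equivariant section. The variables are lifted one after the other, from the last one to the first: an
arbitrary preimage of a variable is corrected by an element of the kernel of `π`, which exists since
the first cohomology with values in the kernel vanishes. -/
lemma exists_section (ht : ∑ g, ρ g t = 1) (π : A →ₐ[k] MvPolynomial (Fin n) k)
    (hsurj : Function.Surjective π) (hπ : ∀ g a, π (ρ g a) = T.ρ g (π a)) :
    ∃ y : Fin n → A, (∀ i, π (y i) = X i) ∧ ∀ g i, ρ g (y i) = y i + aeval y (T.f g i) := by
  have key : ∀ m : ℕ, ∃ y : Fin n → A, ∀ i : Fin n, n ≤ i + m →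
      π (y i) = X i ∧ ∀ g, ρ g (y i) = y i + aeval y (T.f g i) := by
    intro m
    induction m with
    | zero => exact ⟨0, fun i hi => absurd i.2 (by omega)⟩
    | succ m ih =>
      obtain ⟨y, hy⟩ := ih
      by_cases hm : n ≤ m
      · exact ⟨y, fun i _ => hy i (by omega)⟩
      let i₀ : Fin n := ⟨n - m - 1, by omega⟩
      have hgt : ∀ j : Fin n, i₀ < j → n ≤ j + m := by
        intro j hj
        have : n - m - 1 < j := hj
        omega
      have hequi : ∀ g, ∀ b ∈ supported k (Set.Ioi i₀),
          aeval y (T.ρ g b) = ρ g (aeval y b) := by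
        intro g b hb
        refine algHom_eq_of_mem_supported (φ := (aeval y).comp (T.ρ g))
          (ψ := (ρ g).comp (aeval y)) (fun j hj => ?_) hb
        simp only [AlgHom.comp_apply, T.ρ_X, map_add, aeval_X, (hy j (hgt j hj)).2 g]
      have hsec : ∀ b ∈ supported k (Set.Ioi i₀), π (aeval y b) = b := by
        intro b hb
        refine algHom_eq_of_mem_supported (φ := π.comp (aeval y)) (ψ := AlgHom.id k _)
          (fun j hj => ?_) hb
        simp only [AlgHom.comp_apply, aeval_X, AlgHom.id_apply, (hy j (hgt j hj)).1]
      obtain ⟨d, hd⟩ := hsurj (X i₀)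
      let h : G → A := fun g => ρ g d - d - aeval y (T.f g i₀)
      have hh : ∀ g x, h (g * x) = h g + ρ g (h x) := by
        intro g x
        simp only [h, T.f_mul, map_mul, AlgHom.mul_apply, map_add, map_sub,
          hequi g _ (T.f_mem x i₀)]
        ring
      have hπh : ∀ g, π (h g) = 0 := by
        intro g
        simp only [h, map_sub, hπ, hd, T.ρ_X, hsec _ (T.f_mem g i₀)]
        ring
      have he := cocycle_eq_coboundary ρ ht h hh
      set e : A := -∑ x, h x * ρ x t with he_def
      have hπe : π e = 0 := by
        simp [he_def, hπh]
      have hupd : ∀ b ∈ supported k (Set.Ioi i₀),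
          aeval (Function.update y i₀ (d - e)) b = aeval y b := by
        intro b hb
        refine algHom_eq_of_mem_supported (fun j hj => ?_) hb
        rw [aeval_X, aeval_X, Function.update_of_ne (ne_of_gt hj)]
      refine ⟨Function.update y i₀ (d - e), fun i hi => ?_⟩
      by_cases hii : i = i₀
      · subst hii
        refine ⟨by rw [Function.update_self, map_sub, hd, hπe, sub_zero], fun g => ?_⟩
        rw [hupd _ (T.f_mem g _), Function.update_self, map_sub,
          show ρ g e = e + h g by rw [← he g]; ring]
        simp only [h]
        ring
      · have hlt : i₀ < i := by
          refine lt_of_le_of_ne ?_ (Ne.symm hii)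
          change n - m - 1 ≤ (i : ℕ)
          omega
        refine ⟨by rw [Function.update_of_ne hii]; exact (hy i (hgt i hlt)).1, fun g => ?_⟩
        rw [hupd _ (supported_mono (Set.Ioi_subset_Ioi hlt.le) (T.f_mem g i)),
          Function.update_of_ne hii]
        exact (hy i (hgt i hlt)).2 g
  obtain ⟨y, hy⟩ := key n
  exact ⟨y, fun i => (hy i (by omega)).1, fun g i => (hy i (by omega)).2 g⟩

/-- A triangular model embeds equivariantly into `D_k` as a retract: the generating orbit makes it a
quotient of `D_k`, and the quotient map has an equivariant section. -/
lemma exists_polynomialRetract :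
    ∃ P : PolynomialRetract k G n, ∀ (g : G) (b : MvPolynomial (Fin n) k),
      g • aeval P.y b = aeval P.y (T.ρ g b) := by
  obtain ⟨π, hπ, hπg⟩ := DSym.exists_hom T.ρ T.trace_w
  have hsurj : Function.Surjective π := by
    rw [← AlgHom.range_eq_top, eq_top_iff, ← T.adjoin_orbit]
    refine Algebra.adjoin_le ?_
    rintro _ ⟨g, rfl⟩
    exact hπ g
  obtain ⟨y, hy, hyg⟩ := T.exists_section (DSym.actHom k G) (DSym.sum_actHom_mk_X k G) π hsurj hπg
  have hsec : ∀ b, π (aeval y b) = b := by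
    intro b
    have h : π.comp (aeval y) = AlgHom.id k _ := by
      ext i : 1
      simp [hy]
    exact DFunLike.congr_fun h b
  have hequi : ∀ (g : G) b, g • aeval y b = aeval y (T.ρ g b) := by
    intro g b
    have h : (DSym.actHom k G g).comp (aeval y) = (aeval y).comp (T.ρ g) := by
      ext i : 1
      simp [hyg, T.ρ_X]
    exact DFunLike.congr_fun h b
  refine ⟨⟨y, fun b b' h => ?_, ⟨?_, ?_, RingHom.ker π, ?_, ?_⟩⟩, hequi⟩
  · rw [← hsec b, h, hsec]
  · rw [Algebra.adjoin_range_eq_range_aeval]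
    rintro g _ ⟨b, rfl⟩
    exact ⟨T.ρ g b, (hequi g b).symm⟩
  · rw [Algebra.adjoin_range_eq_range_aeval]
    rintro _ ⟨b, rfl⟩ hb
    refine ⟨aeval y (b * T.w), ⟨_, rfl⟩, ?_⟩
    have hb' : ∀ g, T.ρ g b = b := by
      intro g
      have h := congrArg π (hb g)
      change π (g • aeval y b) = π (aeval y b) at h
      rwa [hequi, hsec, hsec] at h
    simp_rw [hequi, map_mul (T.ρ _), hb']
    rw [← map_sum, ← Finset.mul_sum, T.trace_w, mul_one]
    rfl
  · intro g x hx
    rw [RingHom.mem_ker] at hx ⊢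
    change π x = 0 at hx
    change π (g • x) = 0
    rw [hπg, hx, map_zero]
  · rw [Algebra.adjoin_range_eq_range_aeval]
    refine IsCompl.of_eq ?_ ?_
    · rw [eq_bot_iff]
      rintro _ ⟨⟨b, rfl⟩, hb⟩
      have h : π (aeval y b) = 0 := hb
      rw [hsec] at h
      rw [Submodule.mem_bot, h]
      exact map_zero (aeval y)
    · rw [eq_top_iff]
      intro x _
      refine Submodule.mem_sup.2 ⟨aeval y (π x), ⟨_, rfl⟩, x - aeval y (π x), ?_, by abel⟩
      change π (x - aeval y (π x)) = 0
      rw [map_sub, hsec, sub_self]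

end TriangularModel

theorem exists_triangular_polynomialRetract {k : Type*} [Field k] (p : ℕ) [Fact p.Prime]
    [CharP k p] {G : Type*} [Group G] [Fintype G] (n : ℕ) (hG : Fintype.card G = p ^ n) :
    ∃ (P : PolynomialRetract k G n) (f : G → Fin n → MvPolynomial (Fin n) k),
      P.IsTriangular f ∧
      (∃ γ, P.SolvesCohomologyEquations p f γ) ∧
      ∀ γ, P.SolvesCohomologyEquations p f γ →
        ∃ S : P.InvariantGenerators, ∀ i, S.σ i = X i - X i ^ p + γ i := by
  obtain ⟨T, hγ, hT⟩ := exists_triangularModel (k := k) n hG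
  obtain ⟨P, hP⟩ := T.exists_polynomialRetract
  have hinj : ∀ b b', aeval P.y b = aeval P.y b' ↔ b = b' := fun b b' =>
    ⟨fun h => P.algebraicIndependent h, fun h => by rw [h]⟩
  have hsol : ∀ γ, P.SolvesCohomologyEquations p T.f γ ↔ T.IsSolution p γ := by
    intro γ
    refine forall_congr' fun i => and_congr_right fun _ => forall_congr' fun g => ?_
    rw [hP, ← map_sub, ← map_pow, ← map_sub, hinj]
  refine ⟨P, T.f, fun g i => ⟨T.f_mem g i, ?_⟩, ?_, fun γ hγ => ?_⟩
  · have h := hP g (X i)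
    rwa [T.ρ_X, map_add, aeval_X] at h
  · obtain ⟨γ, h⟩ := hγ
    exact ⟨γ, (hsol γ).2 h⟩
  · have hγ' := (hsol γ).1 hγ
    obtain ⟨h1, h2⟩ := hT γ hγ'
    refine ⟨⟨_, h1, fun u => ?_⟩, fun i => rfl⟩
    simp_rw [hP, hinj]
    refine ⟨fun hu g => ?_, h2 u⟩
    refine (Algebra.adjoin_le (S := AlgHom.equalizer (T.ρ g) (AlgHom.id k _)) ?_) hu
    rintro _ ⟨i, rfl⟩
    have h3 : T.ρ g (γ i) = γ i + (T.f g i ^ p - T.f g i) := by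
      rw [← (hγ' i).2 g]
      ring
    change T.ρ g (X i - X i ^ p + γ i) = X i - X i ^ p + γ i
    rw [map_add, map_sub, map_pow, T.ρ_X, h3, add_pow_char (X i) (T.f g i) p]
    ring

/-! ### Trace-surjective algebras as fibres -/

namespace PolynomialRetract

variable {k G : Type*} [Field k] [Group G] [Fintype G] {n : ℕ} (P : PolynomialRetract k G n)

/-- The action of `G` on `U = k[Y 0, …, Y (n - 1)]`, on the level of polynomials. -/
noncomputable def transHom : G →* (MvPolynomial (Fin n) k →ₐ[k] MvPolynomial (Fin n) k) where
  toFun g := aeval (P.trans g)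
  map_one' := by
    ext i : 1
    simp [trans_one]
  map_mul' g h := by
    ext i : 1
    rw [AlgHom.mul_apply, aeval_X, aeval_X, trans_mul]

lemma aeval_transHom (g : G) (u : MvPolynomial (Fin n) k) :
    aeval P.y (P.transHom g u) = g • aeval P.y u :=
  P.aeval_aeval_trans g u

lemma exists_sum_transHom_eq_one : ∃ w, ∑ g, P.transHom g w = 1 := by
  obtain ⟨b, hb, hb1⟩ := P.standard.traceSurjective 1 (one_mem _) fun g => smul_one g
  rw [Algebra.adjoin_range_eq_range_aeval] at hb
  obtain ⟨w, rfl⟩ := hb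
  refine ⟨w, P.algebraicIndependent ?_⟩
  rw [map_sum, map_one]
  simp_rw [aeval_transHom]
  exact hb1

namespace InvariantGenerators

variable {P} (S : P.InvariantGenerators)

lemma mem_adjoin_iff_transHom (u : MvPolynomial (Fin n) k) :
    u ∈ Algebra.adjoin k (Set.range S.σ) ↔ ∀ g, P.transHom g u = u := by
  rw [S.mem_adjoin_iff]
  refine forall_congr' fun g => ?_
  rw [← aeval_transHom]
  exact ⟨fun h => P.algebraicIndependent h, fun h => by rw [h]⟩

variable {R A : Type*} [CommRing R] [Algebra k R] [CommRing A] [Algebra k A] [Algebra R A]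
  [IsScalarTower k R A] {r : Fin n → R} {φ : MvPolynomial (Fin n) k →ₐ[k] A}

lemma aeval_map_eq (u : MvPolynomial (Fin n) k) :
    aeval (R := R) (fun i => φ (X i)) (map (algebraMap k R) u) = φ u := by
  rw [aeval_map_algebraMap]
  exact DFunLike.congr_fun (aeval_unique φ).symm u

/-- The `R`-algebra homomorphism from the fibre over `r` that extends `φ : U → A`. -/
noncomputable def fiberHom (hr : ∀ i, algebraMap R A (r i) = φ (S.σ i)) : S.Fiber R r →ₐ[R] A :=
  Ideal.Quotient.liftₐ (S.fiberIdeal R r) (aeval fun i => φ (X i)) (by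
    intro a ha
    refine (Ideal.span_le (I := RingHom.ker (aeval (R := R) fun i => φ (X i)))).2 ?_ ha
    rintro _ ⟨i, rfl⟩
    rw [SetLike.mem_coe, RingHom.mem_ker, map_sub, aeval_map_eq, ← algebraMap_eq,
      AlgHom.commutes, hr, sub_self])

variable (R r) in
/-- The canonical map from `R[Y 0, …, Y (n - 1)]` to the fibre. -/
noncomputable def fiberMk : MvPolynomial (Fin n) R →ₐ[R] S.Fiber R r :=
  Ideal.Quotient.mkₐ R (S.fiberIdeal R r)

lemma fiberMk_surjective : Function.Surjective (S.fiberMk R r) :=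
  Ideal.Quotient.mk_surjective

lemma smul_fiberMk (g : G) (u : MvPolynomial (Fin n) R) :
    g • S.fiberMk R r u = S.fiberMk R r (P.polyAct R g u) := rfl

lemma fiberMk_σ (i : Fin n) :
    S.fiberMk R r (map (algebraMap k R) (S.σ i)) = algebraMap R _ (r i) := by
  have h : map (algebraMap k R) (S.σ i) - C (r i) ∈ S.fiberIdeal R r :=
    Ideal.subset_span ⟨i, rfl⟩
  exact Ideal.Quotient.eq.2 h

/-- In the fibre, an invariant of `U` becomes the scalar that it becomes in `A`. -/
lemma fiberMk_map_eq_algebraMap (hr : ∀ i, algebraMap R A (r i) = φ (S.σ i))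
    (hinj : Function.Injective (algebraMap R A))
    {u : MvPolynomial (Fin n) k} (hu : ∀ g, P.transHom g u = u) {c : R}
    (hc : algebraMap R A c = φ u) :
    S.fiberMk R r (map (algebraMap k R) u) = algebraMap R _ c := by
  have h : ∃ c', algebraMap R A c' = φ u ∧
      S.fiberMk R r (map (algebraMap k R) u) = algebraMap R _ c' := by
    have hu' := (S.mem_adjoin_iff_transHom u).2 hu
    clear hc hu
    induction hu' using Algebra.adjoin_induction with
    | mem u hu =>
      obtain ⟨i, rfl⟩ := hu
      exact ⟨r i, hr i, S.fiberMk_σ i⟩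
    | algebraMap a =>
      refine ⟨algebraMap k R a, ?_, ?_⟩
      · rw [AlgHom.commutes, ← IsScalarTower.algebraMap_apply]
      · rw [algebraMap_eq, map_C, ← algebraMap_eq, AlgHom.commutes]
    | add a b _ _ ha hb =>
      obtain ⟨c, h1, h2⟩ := ha
      obtain ⟨d, h3, h4⟩ := hb
      exact ⟨c + d, by simp only [map_add, h1, h3], by simp only [map_add, h2, h4]⟩
    | mul a b _ _ ha hb =>
      obtain ⟨c, h1, h2⟩ := ha
      obtain ⟨d, h3, h4⟩ := hb
      exact ⟨c * d, by simp only [map_mul, h1, h3], by simp only [map_mul, h2, h4]⟩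
  obtain ⟨c', h1, h2⟩ := h
  rw [h2, hinj (h1.trans hc.symm)]

variable (hr : ∀ i, algebraMap R A (r i) = φ (S.σ i))

lemma fiberHom_fiberMk (u : MvPolynomial (Fin n) R) :
    S.fiberHom hr (S.fiberMk R r u) = aeval (fun i => φ (X i)) u := rfl

variable [MulSemiringAction G A]

lemma fiberHom_smul (hφ : ∀ (g : G) u, φ (P.transHom g u) = g • φ u)
    (hR : ∀ (g : G) (c : R), g • algebraMap R A c = algebraMap R A c) (g : G) (x : S.Fiber R r) :
    S.fiberHom hr (g • x) = g • S.fiberHom hr x := by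
  obtain ⟨u, rfl⟩ := S.fiberMk_surjective x
  rw [smul_fiberMk, fiberHom_fiberMk, fiberHom_fiberMk]
  induction u using MvPolynomial.induction_on with
  | C c => rw [← algebraMap_eq, AlgHom.commutes, AlgHom.commutes, hR]
  | add a b ha hb => rw [map_add, map_add, map_add, ha, hb, smul_add]
  | mul_X a i ha =>
    have hX : P.polyAct R g (X i) = map (algebraMap k R) (P.transHom g (X i)) := by
      simp [polyAct, transHom]
    rw [map_mul, map_mul, map_mul, ha, smul_mul', hX, aeval_map_eq, hφ, aeval_X]

/-- With Galois coordinates `(xᵢ, yᵢ)` in `U`, the inverse of the map from the fibre to `A` is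
`a ↦ ∑ tr(a φ(yᵢ)) xᵢ`. -/
lemma fiberHom_bijective {p : ℕ} [hp : Fact p.Prime] [CharP k p] (hG : Fintype.card G = p ^ n)
    (hφ : ∀ (g : G) u, φ (P.transHom g u) = g • φ u)
    (hinj : Function.Injective (algebraMap R A))
    (hR : ∀ a : A, a ∈ (algebraMap R A).range ↔ ∀ g : G, g • a = a) :
    Function.Bijective (S.fiberHom hr) := by
  obtain ⟨w, hw⟩ := P.exists_sum_transHom_eq_one
  obtain ⟨Γ, hΓ1, hΓ⟩ := exists_galois_coordinates P.transHom hp.out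
    (CharP.cast_eq_zero (MvPolynomial (Fin n) k) p) hG hw
  have hexists : ∀ a : A, ∃ c : R, algebraMap R A c = ∑ g : G, g • a := by
    intro a
    refine (hR _).2 fun g => ?_
    rw [Finset.smul_sum]
    refine Fintype.sum_equiv (Equiv.mulLeft g) _ _ fun x => ?_
    rw [smul_smul, Equiv.coe_mulLeft]
  choose c hc using hexists
  have hfix : ∀ (g : G) (s : R), g • algebraMap R A s = algebraMap R A s :=
    fun g s => (hR _).1 ⟨s, rfl⟩ g
  let tr : A →ₗ[R] R :=
    { toFun := c
      map_add' := fun a b => hinj (by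
        rw [map_add, hc, hc, hc, ← Finset.sum_add_distrib]
        simp_rw [smul_add])
      map_smul' := fun s a => hinj (by
        simp only [RingHom.id_apply, smul_eq_mul, map_mul, hc, Algebra.smul_def, smul_mul', hfix]
        rw [Finset.mul_sum]) }
  have htr : ∀ a, algebraMap R A (tr a) = ∑ g : G, g • a := hc
  let L : A →ₗ[R] S.Fiber R r := ∑ s ∈ Γ,
    (tr ∘ₗ LinearMap.mulRight R (φ s.2)).smulRight
      (S.fiberMk R r (map (algebraMap k R) s.1))
  have hL : ∀ a, L a = ∑ s ∈ Γ,
      tr (a * φ s.2) • S.fiberMk R r (map (algebraMap k R) s.1) := by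
    intro a
    simp [L]
  -- It suffices to invert on the image of `U`, which spans the fibre over `R`.
  have hleft : ∀ x, L (S.fiberHom hr x) = x := by
    have hU : ∀ u, L (φ u) = S.fiberMk R r (map (algebraMap k R) u) := by
      intro u
      have h1 : ∀ v, algebraMap R (S.Fiber R r) (tr (φ v)) =
          S.fiberMk R r (map (algebraMap k R) (∑ g, P.transHom g v)) := by
        intro v
        refine (S.fiberMk_map_eq_algebraMap hr hinj (fun g => ?_) ?_).symm
        · rw [map_sum]
          refine Fintype.sum_equiv (Equiv.mulLeft g) _ _ fun x => ?_
          rw [Equiv.coe_mulLeft, map_mul, AlgHom.mul_apply]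
        · rw [htr, map_sum]
          simp_rw [hφ]
      have h2 : ∑ s ∈ Γ, (∑ g, P.transHom g (u * s.2)) * s.1 = u := by
        simp_rw [Finset.sum_mul]
        rw [Finset.sum_comm, Finset.sum_eq_single (1 : G)]
        · simp_rw [map_one, AlgHom.one_apply, mul_assoc]
          rw [← Finset.mul_sum]
          simp_rw [mul_comm _ (Prod.fst _)]
          rw [hΓ1, mul_one]
        · intro g _ hg
          simp_rw [map_mul, mul_assoc]
          rw [← Finset.mul_sum]
          simp_rw [mul_comm _ (Prod.fst _)]
          rw [hΓ g hg, mul_zero]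
        · exact fun h => absurd (Finset.mem_univ _) h
      rw [hL]
      conv_rhs => rw [← h2, map_sum, map_sum]
      refine Finset.sum_congr rfl fun s _ => ?_
      rw [← map_mul φ, Algebra.smul_def, h1, map_mul, map_mul]
    intro x
    obtain ⟨u, rfl⟩ := S.fiberMk_surjective x
    rw [fiberHom_fiberMk]
    induction u using MvPolynomial.induction_on' with
    | monomial m s =>
      have h : monomial m s = s • map (algebraMap k R) (monomial m 1) := by
        rw [map_monomial, map_one, smul_monomial, smul_eq_mul, mul_one]
      rw [h, map_smul, map_smul, map_smul, aeval_map_eq, hU]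
    | add a b ha hb => rw [map_add, map_add, map_add, ha, hb]
  refine ⟨Function.LeftInverse.injective hleft, fun a => ⟨L a, ?_⟩⟩
  rw [hL, map_sum]
  simp_rw [map_smul, Algebra.smul_def, htr, fiberHom_fiberMk, aeval_map_eq, Finset.sum_mul]
  rw [Finset.sum_comm, Finset.sum_eq_single (1 : G)]
  · simp_rw [one_smul, mul_assoc, ← map_mul φ]
    rw [← Finset.mul_sum, ← map_sum]
    simp_rw [mul_comm _ (Prod.fst _)]
    rw [hΓ1, map_one, mul_one]
  · intro g _ hg
    simp_rw [smul_mul', ← hφ, mul_assoc, ← map_mul φ]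
    rw [← Finset.mul_sum, ← map_sum]
    simp_rw [mul_comm _ (Prod.fst _)]
    rw [hΓ g hg, map_zero, mul_zero]
  · exact fun h => absurd (Finset.mem_univ _) h

end InvariantGenerators

/-- A trace-surjective algebra receives an equivariant homomorphism from `U`, by restriction from
`D_k`. -/
lemma exists_equivariant_hom {A : Type*} [CommRing A] [Algebra k A] [MulSemiringAction G A]
    [SMulCommClass G k A] (hA : IsTraceSurjective G A) :
    ∃ φ : MvPolynomial (Fin n) k →ₐ[k] A, ∀ (g : G) u, φ (P.transHom g u) = g • φ u := by
  obtain ⟨a, ha⟩ := hA 1 fun g => smul_one g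
  let ρ : G →* (A →ₐ[k] A) :=
    { toFun := fun g => MulSemiringAction.toAlgHom k A g
      map_one' := AlgHom.ext fun x => one_smul G x
      map_mul' := fun g h => AlgHom.ext fun x => mul_smul g h x }
  obtain ⟨ψ, -, hψ⟩ := DSym.exists_hom ρ ha
  refine ⟨ψ.comp (aeval P.y), fun g u => ?_⟩
  rw [AlgHom.comp_apply, AlgHom.comp_apply, aeval_transHom, hψ]
  rfl

end PolynomialRetract

end PGroupTs

theorem theorem1p2 {k : Type*} [Field k] (p : ℕ) [Fact p.Prime] [CharP k p]
    {G : Type*} [Group G] [Fintype G] (n : ℕ) (hG : Fintype.card G = p ^ n) :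
    (∃ (P : PGroupTs.PolynomialRetract k G n) (f : G → Fin n → MvPolynomial (Fin n) k),
      P.IsTriangular f ∧
      (∃ γ, P.SolvesCohomologyEquations p f γ) ∧
      ∀ γ, P.SolvesCohomologyEquations p f γ →
        ∃ S : P.InvariantGenerators, ∀ i, S.σ i = X i - X i ^ p + γ i) ∧
    (∀ (P : PGroupTs.PolynomialRetract k G n) (S : P.InvariantGenerators)
      {R : Type*} [CommRing R] [Algebra k R]
      {A : Type*} [CommRing A] [Algebra k A] [Algebra R A] [IsScalarTower k R A]
      [MulSemiringAction G A] [SMulCommClass G k A],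
      PGroupTs.IsTraceSurjective G A →
      Function.Injective (algebraMap R A) →
      (∀ a : A, a ∈ (algebraMap R A).range ↔ ∀ g : G, g • a = a) →
      ∃ (r : Fin n → R) (e : S.Fiber R r ≃ₐ[R] A),
        ∀ (g : G) (x : S.Fiber R r), e (g • x) = g • e x) := by
  refine ⟨PGroupTs.exists_triangular_polynomialRetract p n hG, ?_⟩
  intro P S R _ _ A _ _ _ _ _ _ hA hinj hR
  obtain ⟨φ, hφ⟩ := P.exists_equivariant_hom hA
  have hr : ∀ i, ∃ c : R, algebraMap R A c = φ (S.σ i) := by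
    refine fun i => (hR _).2 fun g => ?_
    rw [← hφ, (S.mem_adjoin_iff_transHom _).1 (Algebra.subset_adjoin ⟨i, rfl⟩)]
  choose r hr using hr
  refine ⟨r, AlgEquiv.ofBijective (S.fiberHom hr) (S.fiberHom_bijective hr hG hφ hinj hR), ?_⟩
  exact S.fiberHom_smul hr hφ fun g c => (hR _).1 ⟨c, rfl⟩ g
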